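/- **Setting.** Let $\|\cdot\|$ be the Euclidean norm on $\mathbb{R}^d$, let $\mathcal S$ be a set, and for each $s\in\mathcal S$ let $f(\cdot;s):\mathbb{R}^d\to\mathbb{R}$ be convex and $L$-Lipschitz ($L>0$), with a fixed measurable subgradient selection $g_s(x)\in\partial f(x;s)$ for all $x$. For $\rho>0$ let $\gamma_\rho$ be the density of $\mathcal N(0,\rho^2\mathbf I_d)$. Fix $\bar x\in\mathbb{R}^d$, $r,\rho,\beta>0$, $T\in\mathbb{N}$ with $T\ge 1$, $n\ge1$, and let $\Pi$ be the Euclidean projection onto $\{x:\|x-\bar x\|\le r\}$. Put $$k=\lfloor\log_2T\rfloor,\quad \eta=\frac rL\min\Big(\frac1{\sqrt T},\frac{\beta}{\sqrt d}\Big),\quad T_i=2^{k-i},\quad \eta_i=4^{-i}\eta,\quad \sigma_i=\frac{L\eta_i}{\beta}\qquad(1\le i\le k).$$ **Solver.** Given a dataset $\mathcal D=(s_1,\dots,s_n)\in\mathcal S^n$ and indices $z_{i,j}\in\{1,\dots,n\}$ ($1\le i\le k$, $1\le j\le T_i$), start from $x_0=\bar x$. For $i=1,\dots,k$, set $y_0=x_{i-1}$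 and, for $j=1,\dots,T_i$, $$y_j=\Pi\Big(y_{j-1}-\eta_i\,\frac{\gamma_\rho(y_{j-1}-\bar x-\xi_{i,j})}{\gamma_\rho(\xi_{i,j})}\,g_{s_{z_{i,j}}}(\bar x+\xi_{i,j})\Big),\qquad \xi_{i,j}\sim\mathcal N(0,\rho^2\mathbf I_d),$$ and then $x_i=\frac1{T_i}\sum_{j=1}^{T_i}y_j+\zeta_i$ with $\zeta_i\sim\mathcal N(0,\sigma_i^2\mathbf I_d)$. All $\xi_{i,j}$ and $\zeta_i$ are independent. The output is $x_k$. **Divergences.** For probability measures $\mu,\nu$ on $\mathbb{R}^d$ and $\alpha>1$, let $D_\alpha(\mu\|\nu)=\frac1{\alpha-1}\log\int(\frac{d\mu}{d\nu})^\alpha d\nu$ if $\mu\ll\nu$ and $D_\alpha(\mu\|\nu)=\infty$ otherwise. Let $D_{\mathrm{TV}}(\mu,\nu)=\frac12\int|\mu(\omega)-\nu(\omega)|\,d\omega$, with $\mu(\omega),\nu(\omega)$ the densities with respect to a common dominating measure. Let $$D_{\alpha,\delta}(\mu\|\nu)=\inf\{D_\alpha(\tilde\mu\|\tilde\nu): D_{\mathrm{TV}}(\tilde\mu,\mu)\le\delta,\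 D_{\mathrm{TV}}(\tilde\nu,\nu)\le\delta\}$$ over probability measures $\tilde\mu,\tilde\nu$. **Lemma.** Let $\mathcal D,\mathcal D'\in\mathcal S^n$ differ in exactly one entry, namely the first. Fix the indices $z_{i,j}$, let $b$ be the number of pairs $(i,j)$ with $z_{i,j}=1$, and let $\mu$, $\mu'$ be the distributions of the output of the solver with these indices on $\mathcal D$ and $\mathcal D'$, respectively. Let $\delta>0$ and suppose, with $\log$ the natural logarithm and the condition being void if $T=1$, that $$\frac\rho r\ \ge\ 1728\,\log^2\!\Big(\frac{\log T}{\delta}\Big).$$ Then for every $\alpha>1$, $$D_{\alpha,\delta}(\mu\|\mu')\ \le\ 1500\,\alpha\,\beta^2b^2,$$ and there are admissible $\tilde\mu,\tilde\nu$ in the infimum with $D_\alpha(\tilde\mu\|\tilde\nu)\le1500\,\alpha\,\beta^2b^2$. -/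

import Mathlib

open MeasureTheory ProbabilityTheory
open scoped ENNReal

noncomputable section

namespace ReSQue

/-- The space `ℝ^d` with its Euclidean norm. -/
abbrev E (d : ℕ) : Type := EuclideanSpace ℝ (Fin d)

/-! ### Divergences -/

/-- Total variation distance `(1/2) ∫ |μ(ω) - ν(ω)| dω`, the densities being taken with respect to
the common dominating measure `μ + ν`. -/
def tvDist {Ω : Type*} [MeasurableSpace Ω] (μ ν : Measure Ω) : ℝ :=
  (1 / 2) * ∫ ω, |(μ.rnDeriv (μ + ν) ω).toReal - (ν.rnDeriv (μ + ν) ω).toReal| ∂(μ + ν)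

open Classical in
/-- The `α`-Rényi divergence `(1 / (α - 1)) log ∫ (dμ/dν)^α dν` with values in `[-∞, ∞]`,
equal to `∞` if `μ` is not absolutely continuous with respect to `ν`. -/
def renyiDiv {Ω : Type*} [MeasurableSpace Ω] (α : ℝ) (μ ν : Measure Ω) : EReal :=
  if μ ≪ ν then ((1 / (α - 1) : ℝ) : EReal) * ENNReal.log (∫⁻ ω, (μ.rnDeriv ν ω) ^ α ∂ν) else ⊤

/-- The approximate Rényi divergence `D_{α,δ}(μ ‖ ν)`: the infimum of `D_α(μ' ‖ ν')` over all
probability measures `μ'`, `ν'` within total variation distance `δ` of `μ`, `ν` respectively. -/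
def approxRenyiDiv {Ω : Type*} [MeasurableSpace Ω] (α δ : ℝ) (μ ν : Measure Ω) : EReal :=
  ⨅ (μ' : ProbabilityMeasure Ω) (ν' : ProbabilityMeasure Ω)
    (_ : tvDist (μ' : Measure Ω) μ ≤ δ) (_ : tvDist (ν' : Measure Ω) ν ≤ δ),
    renyiDiv α (μ' : Measure Ω) (ν' : Measure Ω)

/-! ### Subgradients, projections, Gaussians, the ReSQue estimator -/

/-- `v ∈ ∂f(x)`. -/
def IsSubgradient {d : ℕ} (f : E d → ℝ) (x v : E d) : Prop :=
  ∀ y, f x + inner ℝ v (y - x) ≤ f y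

/-- Two datasets are neighboring if they differ in exactly one entry. -/
def Neighboring {S : Type*} {n : ℕ} (D D' : Fin n → S) : Prop :=
  {i | D i ≠ D' i}.ncard = 1

/-- Euclidean projection onto the closed ball of radius `r` around `c`
(see `ballProj_mem`, `ballProj_unique`). -/
def ballProj {d : ℕ} (c : E d) (r : ℝ) (x : E d) : E d :=
  if ‖x - c‖ ≤ r then x else c + (r / ‖x - c‖) • (x - c)

theorem ballProj_mem {d : ℕ} (c : E d) {r : ℝ} (hr : 0 ≤ r) (x : E d) :
    ballProj c r x ∈ Metric.closedBall c r := by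
  unfold ballProj
  split_ifs with h
  · exact mem_closedBall_iff_norm.2 h
  · have hpos : 0 < ‖x - c‖ := lt_of_le_of_lt hr (not_le.mp h)
    rw [mem_closedBall_iff_norm, add_sub_cancel_left, norm_smul, Real.norm_eq_abs,
      abs_of_nonneg (by positivity), div_mul_cancel₀ _ hpos.ne']

/-- `ballProj c r x` is the unique point of the ball nearest to `x`: it satisfies
`‖x - ballProj c r x‖² + ‖y - ballProj c r x‖² ≤ ‖x - y‖²` for all `y` in the ball. -/
theorem ballProj_unique {d : ℕ} (c : E d) {r : ℝ} (hr : 0 ≤ r) (x y : E d)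
    (hy : y ∈ Metric.closedBall c r) :
    ‖x - ballProj c r x‖ ^ 2 + ‖y - ballProj c r x‖ ^ 2 ≤ ‖x - y‖ ^ 2 := by
  rw [mem_closedBall_iff_norm] at hy
  unfold ballProj
  split_ifs with h
  · simp [norm_sub_rev]
  · have hlt : r < ‖x - c‖ := not_le.mp h
    have hpos : 0 < ‖x - c‖ := lt_of_le_of_lt hr hlt
    set u := x - c with hu
    set w := y - c with hw
    set t := r / ‖u‖ with ht
    have h1 : x - (c + t • u) = (1 - t) • u := by
      rw [sub_smul, one_smul, hu]; abel
    have h2 : y - (c + t • u) = w - t • u := by rw [hw]; abel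
    have h3 : x - y = u - w := by rw [hu, hw]; abel
    have htr : t * ‖u‖ = r := div_mul_cancel₀ _ hpos.ne'
    have ht0 : 0 ≤ t := by positivity
    have ht1 : t ≤ 1 := (div_le_one hpos).2 hlt.le
    have hcs : inner ℝ u w ≤ ‖u‖ * ‖w‖ := real_inner_le_norm u w
    have hin : inner ℝ u w ≤ t * ‖u‖ ^ 2 := by
      calc inner ℝ u w ≤ ‖u‖ * ‖w‖ := hcs
        _ ≤ ‖u‖ * r := by gcongr
        _ = t * ‖u‖ ^ 2 := by rw [← htr]; ring
    rw [h1, h2, h3, norm_sub_sq_real u w, norm_sub_sq_real w, norm_smul, norm_smul, inner_smul_right,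
      Real.norm_eq_abs, Real.norm_eq_abs, abs_of_nonneg ht0, abs_of_nonneg (by linarith),
      real_inner_comm u w]
    nlinarith [mul_le_mul_of_nonneg_left hin (by linarith : (0 : ℝ) ≤ 1 - t)]

/-- The Gaussian measure `N(0, σ² I_d)`. -/
def gauss (d : ℕ) (σ : ℝ) : Measure (E d) :=
  multivariateGaussian 0 (σ ^ 2 • (1 : Matrix (Fin d) (Fin d) ℝ))

/-- The density `γ_ρ` of `N(0, ρ² I_d)`. -/
def gaussDensity {d : ℕ} (ρ : ℝ) (x : E d) : ℝ :=
  (2 * Real.pi * ρ ^ 2) ^ (-(d : ℝ) / 2) * Real.exp (-(1 / (2 * ρ ^ 2)) * ‖x‖ ^ 2)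

/-- The ReSQue estimator of radius `ρ` with center `xbar` at `x`, with subgradient oracle `g`
and Gaussian sample `ξ`. -/
def estimator {d : ℕ} (xbar : E d) (ρ : ℝ) (g : E d → E d) (ξ x : E d) : E d :=
  (gaussDensity ρ (x - xbar - ξ) / gaussDensity ρ ξ) • g (xbar + ξ)

/-! ### The subsampled ReSQued ERM solver -/

/-- The inputs of the solver other than the dataset: center, ball radius, convolution radius,
privacy parameter, Lipschitz constant, iteration count. -/
structure Params (d : ℕ) where
  xbar : E d
  r : ℝ
  ρ : ℝ
  β : ℝ
  L : ℝ
  T : ℕ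

namespace Params

variable {d : ℕ} (P : Params d)

/-- The number of outer iterations, `k = log₂ T̂ = ⌊log₂ T⌋` where `T̂ = 2 ^ ⌊log₂ T⌋`. -/
def k : ℕ := Nat.log 2 P.T

/-- `T_i = 2^{-i} T̂`, an integer for `1 ≤ i ≤ k`. -/
def Ti (i : ℕ) : ℕ := 2 ^ P.k / 2 ^ i

def η : ℝ := P.r / P.L * min (1 / √(P.T : ℝ)) (P.β / √(d : ℝ))

/-- `η_i = 4^{-i} η`. -/
def ηi (i : ℕ) : ℝ := P.η / 4 ^ i

/-- `σ_i = L η_i / β`. -/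
def σi (i : ℕ) : ℝ := P.L * P.ηi i / P.β

end Params

variable {d : ℕ} {S : Type*} {n : ℕ}

/-- The iterates `y_j` of the `i`-th outer loop started at `y0`, for sampled indices `z i j`
(`1 ≤ i ≤ k`, `1 ≤ j ≤ T_i`) and Gaussian samples `ξ j`. Here `g s` is the subgradient oracle of
the sampled function of `s ∈ S`, and `D` is the dataset. -/
def innerIter (P : Params d) (g : S → E d → E d) (D : Fin n → S) (z : ℕ → ℕ → Fin n) (i : ℕ)
    (y0 : E d) (ξ : ℕ → E d) : ℕ → E d
  | 0 => y0
  | j + 1 =>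
      let y := innerIter P g D z i y0 ξ j
      ballProj P.xbar P.r
        (y - P.ηi i • estimator P.xbar P.ρ (g (D (z i (j + 1)))) (ξ (j + 1)) y)

/-- The average `(1 / T_i) ∑_{1 ≤ j ≤ T_i} y_j`. -/
def innerAvg (P : Params d) (g : S → E d → E d) (D : Fin n → S) (z : ℕ → ℕ → Fin n) (i : ℕ)
    (y0 : E d) (ξ : ℕ → E d) : E d :=
  (1 / (P.Ti i : ℝ)) • ∑ j ∈ Finset.Icc 1 (P.Ti i), innerIter P g D z i y0 ξ j

/-- The law of `x_i`: given `x_{i-1}`, draw fresh independent samples `ξ_{i,j} ∼ N(0, ρ² I_d)` and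
`ζ_i ∼ N(0, σ_i² I_d)`, independent of everything before, and set `x_i = ybar_i + ζ_i`, where
`ybar_i` is the average of the iterates of the `i`-th loop started at `x_{i-1}`. -/
def outerLaw (P : Params d) (g : S → E d → E d) (D : Fin n → S) (z : ℕ → ℕ → Fin n) :
    ℕ → Measure (E d)
  | 0 => Measure.dirac P.xbar
  | i + 1 =>
      ((outerLaw P g D z i).prod
        ((Measure.infinitePi fun _ : ℕ => gauss d P.ρ).prod (gauss d (P.σi (i + 1))))).map
        fun ω => innerAvg P g D z (i + 1) ω.1 ω.2.1 + ω.2.2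

/-- The law of the output `x_k` of the solver, for a fixed realization `z` of the sampled
indices. -/
def outputLaw (P : Params d) (g : S → E d → E d) (D : Fin n → S) (z : ℕ → ℕ → Fin n) :
    Measure (E d) :=
  outerLaw P g D z P.k

/-- The number of times that `a` occurs among the sampled indices `z i j`, `1 ≤ i ≤ k`,
`1 ≤ j ≤ T_i`. -/
def occurrences (P : Params d) (z : ℕ → ℕ → Fin n) (a : Fin n) : ℕ :=
  ∑ i ∈ Finset.Icc 1 P.k, ((Finset.Icc 1 (P.Ti i)).filter fun j => z i j = a).card

end ReSQue

end

/-!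
By Hölder duality, a bound on the order `α` Rényi divergence is an inequality between integrals of
test functions against the two measures, and a total variation bound is an additive one. In this
form both kinds of bound compose along a Markov chain.

Compare the chain on `D'` with a hybrid one, which performs the step of `D'` whenever this differs
from the step of `D` by at most `50 η_i L b_i`, with `b_i` the number of `j` such that `z_{i,j} = a`
for the differing entry `a`, and the step of `D` otherwise. From the chain on `D` the hybrid chain
is separated by at most this much in each step, which the noise `ζ_i` masks at a cost of
`1250 α β² b_i²`. From the chain on `D'` it differs only with the probability that the two inner
averages, run with the same `ξ`, are far apart.

That probability is controlled through the `2m`-th moment of the gap between the two inner loops,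
with `m` of order `log (log T / δ)`. An iteration that does not use the differing entry moves the
gap by a weighted difference of subgradients. In expectation this difference points in the
contracting direction, by monotonicity of the subgradient, and since `ρ` is much larger than `m² r`
the weights concentrate, so that the higher order terms only cost a factor
`1 + 500 m² (η_i L / ρ)²` per iteration.
-/

namespace ReSQue

section Gaussian

variable {d : ℕ} {σ : ℝ}

instance isProbabilityMeasure_gauss (d : ℕ) (σ : ℝ) : IsProbabilityMeasure (gauss d σ) := by
  unfold gauss; infer_instance

theorem gaussDensity_pos (hσ : 0 < σ) (x : E d) : 0 < gaussDensity σ x := by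
  unfold gaussDensity; positivity

theorem measurable_gaussDensity (σ : ℝ) : Measurable (gaussDensity (d := d) σ) := by
  unfold gaussDensity; fun_prop

theorem gaussDensity_neg (x : E d) : gaussDensity σ (-x) = gaussDensity σ x := by
  rw [gaussDensity, gaussDensity, norm_neg]

theorem gaussDensity_mul_cexp (x t : E d) :
    (gaussDensity σ x : ℂ) * Complex.exp (inner ℝ x t * Complex.I) =
      ((2 * Real.pi * σ ^ 2) ^ (-(d : ℝ) / 2) : ℝ) *
        Complex.exp (-((1 / (2 * σ ^ 2) : ℝ) : ℂ) * ‖x‖ ^ 2 + Complex.I * (inner ℝ t x : ℝ)) := by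
  rw [gaussDensity, Complex.ofReal_mul, Complex.ofReal_exp, mul_assoc, ← Complex.exp_add,
    real_inner_comm t x, mul_comm Complex.I]
  push_cast
  rfl

theorem integrable_gaussDensity_mul_cexp (hσ : 0 < σ) (t : E d) :
    Integrable fun x : E d => (gaussDensity σ x : ℂ) * Complex.exp (inner ℝ x t * Complex.I) := by
  have hb : 0 < ((1 / (2 * σ ^ 2) : ℝ) : ℂ).re := by rw [Complex.ofReal_re]; positivity
  simp_rw [gaussDensity_mul_cexp]
  exact (GaussianFourier.integrable_cexp_neg_mul_sq_norm_add hb _ _).const_mul _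

theorem integrable_gaussDensity (hσ : 0 < σ) : Integrable (gaussDensity (d := d) σ) := by
  simpa using (integrable_gaussDensity_mul_cexp hσ (0 : E d)).re

theorem gaussDensity_normalization (hσ : 0 < σ) :
    (((2 * Real.pi * σ ^ 2) ^ (-(d : ℝ) / 2) : ℝ) : ℂ) *
      ((Real.pi : ℂ) / ((1 / (2 * σ ^ 2) : ℝ) : ℂ)) ^ ((Module.finrank ℝ (E d) : ℂ) / 2) = 1 := by
  have hpos : (0 : ℝ) < 2 * Real.pi * σ ^ 2 := by positivity
  have hbase : Real.pi / (1 / (2 * σ ^ 2)) = 2 * Real.pi * σ ^ 2 := by field_simp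
  have hexp : (Module.finrank ℝ (E d) : ℂ) / 2 = ((d / 2 : ℝ) : ℂ) := by
    rw [finrank_euclideanSpace_fin]; push_cast; rfl
  rw [← Complex.ofReal_div, hbase, hexp, ← Complex.ofReal_cpow hpos.le, ← Complex.ofReal_mul,
    ← Real.rpow_add hpos, neg_div, neg_add_cancel, Real.rpow_zero, Complex.ofReal_one]

theorem integral_gaussDensity_mul_cexp (hσ : 0 < σ) (t : E d) :
    ∫ x : E d, (gaussDensity σ x : ℂ) * Complex.exp (inner ℝ x t * Complex.I) =
      Complex.exp (-(σ ^ 2 * ‖t‖ ^ 2 / 2 : ℝ)) := by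
  have hb : 0 < ((1 / (2 * σ ^ 2) : ℝ) : ℂ).re := by rw [Complex.ofReal_re]; positivity
  have hσ' : (σ : ℂ) ≠ 0 := by exact_mod_cast hσ.ne'
  simp_rw [gaussDensity_mul_cexp]
  rw [integral_const_mul, GaussianFourier.integral_cexp_neg_mul_sq_norm_add hb, ← mul_assoc,
    gaussDensity_normalization hσ, one_mul, Complex.I_sq]
  congr 1
  push_cast
  field_simp
  ring

theorem charFun_gauss (σ : ℝ) (t : E d) :
    charFun (gauss d σ) t = Complex.exp (-(σ ^ 2 * ‖t‖ ^ 2 / 2 : ℝ)) := by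
  have hdot : t.ofLp ⬝ᵥ t.ofLp = ‖t‖ ^ 2 := by
    rw [EuclideanSpace.real_norm_sq_eq]; simp [dotProduct, sq]
  rw [gauss, charFun_multivariateGaussian (Matrix.PosSemidef.one.smul (sq_nonneg σ)),
    Matrix.smul_mulVec, Matrix.one_mulVec, dotProduct_smul, hdot]
  simp

theorem gauss_eq_withDensity (hσ : 0 < σ) :
    gauss d σ = volume.withDensity fun x => ENNReal.ofReal (gaussDensity σ x) := by
  have : IsFiniteMeasure
      ((volume : Measure (E d)).withDensity fun x => ENNReal.ofReal (gaussDensity σ x)) :=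
    isFiniteMeasure_withDensity_ofReal (integrable_gaussDensity hσ).2
  refine Measure.ext_of_charFun (funext fun t => ?_)
  rw [charFun_gauss, charFun_apply, integral_withDensity_eq_integral_toReal_smul
    (measurable_gaussDensity σ).ennreal_ofReal (by simp), ← integral_gaussDensity_mul_cexp hσ t]
  refine integral_congr_ae (ae_of_all _ fun x => ?_)
  simp [ENNReal.toReal_ofReal (gaussDensity_pos hσ x).le]

theorem lintegral_gauss (hσ : 0 < σ) {h : E d → ℝ≥0∞} (hh : Measurable h) :
    ∫⁻ ξ, h ξ ∂gauss d σ = ∫⁻ x, ENNReal.ofReal (gaussDensity σ x) * h x := by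
  rw [gauss_eq_withDensity hσ,
    lintegral_withDensity_eq_lintegral_mul _ (measurable_gaussDensity σ).ennreal_ofReal hh]
  rfl

/-- The density of the shifted Gaussian `N(v, ρ² I_d)` with respect to `N(0, ρ² I_d)`. -/
noncomputable def weight (ρ : ℝ) (v ξ : E d) : ℝ :=
  gaussDensity ρ (v - ξ) / gaussDensity ρ ξ

theorem weight_pos (hσ : 0 < σ) (v ξ : E d) : 0 < weight σ v ξ :=
  div_pos (gaussDensity_pos hσ _) (gaussDensity_pos hσ _)

theorem weight_eq_exp (hσ : 0 < σ) (v ξ : E d) :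
    weight σ v ξ = Real.exp ((inner ℝ v ξ - ‖v‖ ^ 2 / 2) / σ ^ 2) := by
  have hpos : 0 < (2 * Real.pi * σ ^ 2) ^ (-(d : ℝ) / 2) := by positivity
  rw [weight, gaussDensity, gaussDensity, mul_div_mul_left _ _ hpos.ne', ← Real.exp_sub,
    norm_sub_sq_real]
  congr 1
  field_simp
  ring

@[fun_prop]
theorem measurable_weight {Ω : Type*} [MeasurableSpace Ω] {v ξ : Ω → E d} (hv : Measurable v)
    (hξ : Measurable ξ) : Measurable fun ω => weight σ (v ω) (ξ ω) :=
  ((measurable_gaussDensity σ).comp (hv.sub hξ)).div ((measurable_gaussDensity σ).comp hξ)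

theorem lintegral_gauss_shift (hσ : 0 < σ) (v : E d) {h : E d → ℝ≥0∞} (hh : Measurable h) :
    ∫⁻ ξ, h (v + ξ) ∂gauss d σ = ∫⁻ ξ, ENNReal.ofReal (weight σ v ξ) * h ξ ∂gauss d σ := by
  rw [lintegral_gauss hσ (h := fun ξ => h (v + ξ)) (by fun_prop),
    lintegral_gauss hσ (by fun_prop), ← lintegral_add_left_eq_self _ (-v)]
  refine lintegral_congr fun x => ?_
  rw [← mul_assoc, ← ENNReal.ofReal_mul (gaussDensity_pos hσ x).le, weight,
    mul_div_cancel₀ _ (gaussDensity_pos hσ x).ne', add_neg_cancel_left, ← gaussDensity_neg,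
    neg_add, neg_neg, sub_eq_add_neg]

theorem map_const_add_gauss (hσ : 0 < σ) (v : E d) :
    (gauss d σ).map (v + ·) = (gauss d σ).withDensity fun ξ => ENNReal.ofReal (weight σ v ξ) := by
  refine Measure.ext_of_lintegral _ fun h hh => ?_
  rw [lintegral_map hh (measurable_const_add v), lintegral_gauss_shift hσ v hh,
    lintegral_withDensity_eq_lintegral_mul _ (by fun_prop) hh]
  rfl

theorem integral_gauss_shift {F : Type*} [NormedAddCommGroup F] [NormedSpace ℝ F] (hσ : 0 < σ)
    (v : E d) (h : E d → F) :
    ∫ ξ, h (v + ξ) ∂gauss d σ = ∫ ξ, weight σ v ξ • h ξ ∂gauss d σ := by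
  have hmap := (MeasurableEquiv.addLeft v).measurableEmbedding.integral_map (μ := gauss d σ) h
  rw [MeasurableEquiv.coe_addLeft, map_const_add_gauss hσ,
    integral_withDensity_eq_integral_toReal_smul (by fun_prop) (by simp)] at hmap
  simpa only [ENNReal.toReal_ofReal (weight_pos hσ v _).le] using hmap.symm

theorem lintegral_weight (hσ : 0 < σ) (v : E d) :
    ∫⁻ ξ, ENNReal.ofReal (weight σ v ξ) ∂gauss d σ = 1 := by
  simpa using (lintegral_gauss_shift hσ v (h := fun _ => 1) measurable_const).symm

theorem integrable_weight (hσ : 0 < σ) (v : E d) : Integrable (weight σ v) (gauss d σ) := by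
  refine ⟨(measurable_weight measurable_const measurable_id).aestronglyMeasurable, ?_⟩
  rw [hasFiniteIntegral_iff_ofReal (ae_of_all _ fun ξ => (weight_pos hσ v ξ).le),
    lintegral_weight hσ]
  exact ENNReal.one_lt_top

theorem lintegral_exp_inner (hσ : 0 < σ) (a : E d) :
    ∫⁻ ξ, ENNReal.ofReal (Real.exp (inner ℝ a ξ)) ∂gauss d σ =
      ENNReal.ofReal (Real.exp (σ ^ 2 * ‖a‖ ^ 2 / 2)) := by
  have hexp : ∀ ξ : E d, ENNReal.ofReal (Real.exp (inner ℝ a ξ)) =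
      ENNReal.ofReal (Real.exp (σ ^ 2 * ‖a‖ ^ 2 / 2)) *
        ENNReal.ofReal (weight σ (σ ^ 2 • a) ξ) := fun ξ => by
    rw [← ENNReal.ofReal_mul (Real.exp_pos _).le, weight_eq_exp hσ, ← Real.exp_add, norm_smul,
      real_inner_smul_left, Real.norm_eq_abs, abs_of_nonneg (sq_nonneg σ)]
    congr 2; field_simp; ring
  simp_rw [hexp]
  rw [lintegral_const_mul _ (by fun_prop), lintegral_weight hσ, mul_one]

theorem lintegral_weight_rpow (hσ : 0 < σ) (v : E d) {p : ℝ} (hp : 0 ≤ p) :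
    ∫⁻ ξ, ENNReal.ofReal (weight σ v ξ) ^ p ∂gauss d σ =
      ENNReal.ofReal (Real.exp (p * (p - 1) * ‖v‖ ^ 2 / (2 * σ ^ 2))) := by
  have hrpow : ∀ ξ : E d, ENNReal.ofReal (weight σ v ξ) ^ p =
      ENNReal.ofReal (Real.exp (-(p * ‖v‖ ^ 2 / (2 * σ ^ 2)))) *
        ENNReal.ofReal (Real.exp (inner ℝ ((p / σ ^ 2) • v) ξ)) := fun ξ => by
    rw [ENNReal.ofReal_rpow_of_nonneg (weight_pos hσ v ξ).le hp, weight_eq_exp hσ,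
      ← Real.exp_mul, ← ENNReal.ofReal_mul (Real.exp_pos _).le, ← Real.exp_add,
      real_inner_smul_left]
    congr 2; field_simp; ring
  simp_rw [hrpow]
  rw [lintegral_const_mul _ (by fun_prop), lintegral_exp_inner hσ,
    ← ENNReal.ofReal_mul (Real.exp_pos _).le, ← Real.exp_add, norm_smul, Real.norm_eq_abs,
    mul_pow, sq_abs]
  congr 2; field_simp; ring

theorem lintegral_exp_sum_abs_inner_le {ι : Type*} (hσ : 0 < σ) (a : ι → E d) (s : Finset ι)
    (b : E d) :
    ∫⁻ ξ, ENNReal.ofReal (Real.exp (inner ℝ b ξ + ∑ i ∈ s, |inner ℝ (a i) ξ|)) ∂gauss d σ ≤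
      2 ^ s.card * ENNReal.ofReal (Real.exp (σ ^ 2 * (‖b‖ + ∑ i ∈ s, ‖a i‖) ^ 2 / 2)) := by
  classical
  induction s using Finset.induction_on generalizing b with
  | empty => simpa using (lintegral_exp_inner hσ b).le
  | insert j s hj ih =>
    set B := ENNReal.ofReal
      (Real.exp (σ ^ 2 * (‖b‖ + (‖a j‖ + ∑ i ∈ s, ‖a i‖)) ^ 2 / 2)) with hB
    have hstep : ∀ c : E d, ‖c‖ ≤ ‖b‖ + ‖a j‖ →
        ∫⁻ ξ, ENNReal.ofReal (Real.exp (inner ℝ c ξ + ∑ i ∈ s, |inner ℝ (a i) ξ|)) ∂gauss d σ ≤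
          2 ^ s.card * B := fun c hc => by
      refine (ih c).trans ?_
      rw [hB, ← add_assoc]
      gcongr
    have hsplit : ∀ ξ : E d,
        ENNReal.ofReal (Real.exp (inner ℝ b ξ + (|inner ℝ (a j) ξ| + ∑ i ∈ s, |inner ℝ (a i) ξ|))) ≤
          ENNReal.ofReal (Real.exp (inner ℝ (b + a j) ξ + ∑ i ∈ s, |inner ℝ (a i) ξ|)) +
            ENNReal.ofReal (Real.exp (inner ℝ (b - a j) ξ + ∑ i ∈ s, |inner ℝ (a i) ξ|)) := by
      intro ξ
      rw [inner_add_left, inner_sub_left]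
      rcases abs_cases (inner ℝ (a j) ξ) with h | h <;> rw [h.1, ← add_assoc]
      · exact le_self_add
      · exact le_add_self
    simp_rw [Finset.sum_insert hj]
    refine (lintegral_mono hsplit).trans ?_
    rw [lintegral_add_left (by fun_prop), Finset.card_insert_of_notMem hj, pow_succ, mul_assoc,
      mul_left_comm, two_mul]
    exact add_le_add (hstep _ (norm_add_le b (a j))) (hstep _ (norm_sub_le b (a j)))

theorem gaussDensity_mul_exp_norm_sq (hσ : 0 < σ) (x : E d) :
    gaussDensity σ x * Real.exp (‖x‖ ^ 2 / (4 * σ ^ 2)) =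
      2 ^ ((d : ℝ) / 2) * gaussDensity (√2 * σ) x := by
  have hvar : 2 * Real.pi * (√2 * σ) ^ 2 = 2 * (2 * Real.pi * σ ^ 2) := by
    rw [mul_pow, Real.sq_sqrt zero_le_two]; ring
  rw [gaussDensity, gaussDensity, hvar, Real.mul_rpow zero_le_two (by positivity), ← mul_assoc,
    ← mul_assoc, ← Real.rpow_add two_pos, neg_div, add_neg_cancel, Real.rpow_zero, one_mul,
    mul_assoc, ← Real.exp_add, mul_pow, Real.sq_sqrt zero_le_two]
  congr 2
  field_simp
  ring

theorem lintegral_exp_norm_sq (hσ : 0 < σ) :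
    ∫⁻ ζ, ENNReal.ofReal (Real.exp (‖ζ‖ ^ 2 / (4 * σ ^ 2))) ∂gauss d σ =
      ENNReal.ofReal (2 ^ ((d : ℝ) / 2)) := by
  have hmass := lintegral_gauss (d := d) (show 0 < √2 * σ by positivity)
    (h := fun _ => 1) measurable_const
  rw [lintegral_one, measure_univ] at hmass
  simp only [mul_one] at hmass
  rw [lintegral_gauss hσ (by fun_prop)]
  simp_rw [← ENNReal.ofReal_mul (gaussDensity_pos hσ _).le, gaussDensity_mul_exp_norm_sq hσ,
    ENNReal.ofReal_mul (Real.rpow_nonneg zero_le_two _)]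
  rw [lintegral_const_mul _ (measurable_gaussDensity _).ennreal_ofReal, ← hmass, mul_one]

theorem gauss_norm_gt_le (hσ : 0 < σ) {R : ℝ} (hR : 0 ≤ R) :
    gauss d σ {ζ | R < ‖ζ‖} ≤
      ENNReal.ofReal (2 ^ ((d : ℝ) / 2) * Real.exp (-(R ^ 2 / (4 * σ ^ 2)))) := by
  set u := Real.exp (R ^ 2 / (4 * σ ^ 2))
  have hmarkov := mul_meas_ge_le_lintegral₀ (μ := gauss d σ)
    (f := fun ζ => ENNReal.ofReal (Real.exp (‖ζ‖ ^ 2 / (4 * σ ^ 2)))) (by fun_prop)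
    (ENNReal.ofReal u)
  rw [lintegral_exp_norm_sq hσ] at hmarkov
  rw [Real.exp_neg, ← div_eq_mul_inv, ENNReal.ofReal_div_of_pos (Real.exp_pos _),
    ENNReal.le_div_iff_mul_le (.inl (by positivity)) (.inl ENNReal.ofReal_ne_top), mul_comm]
  refine le_trans (mul_le_mul_right (measure_mono fun ζ hζ => ?_) _) hmarkov
  have hlt : R < ‖ζ‖ := hζ
  exact ENNReal.ofReal_le_ofReal (Real.exp_le_exp.2 (by gcongr))

end Gaussian

/-- The dual formulation of `D_α(μ ‖ ν) ≤ ε`, where `q` is the exponent conjugate to `α`. Unlike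
the divergence itself it passes through products and images without densities. -/
def RenyiBound {Ω : Type*} [MeasurableSpace Ω] (q ε : ℝ) (μ ν : Measure Ω) : Prop :=
  ∀ u : Ω → ℝ≥0∞, Measurable u →
    ∫⁻ x, u x ∂μ ≤ ENNReal.ofReal (Real.exp (ε / q)) * (∫⁻ x, u x ^ q ∂ν) ^ (1 / q)

/-- The dual formulation of `D_TV(μ, ν) ≤ e`. One-sided, which for probability measures is
equivalent to the symmetric condition. -/
def TVBound {Ω : Type*} [MeasurableSpace Ω] (e : ℝ≥0∞) (μ ν : Measure Ω) : Prop :=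
  ∀ u : Ω → ℝ≥0∞, Measurable u → (∀ x, u x ≤ 1) → ∫⁻ x, u x ∂μ ≤ ∫⁻ x, u x ∂ν + e

section Divergences

variable {Ω Ω' : Type*} [MeasurableSpace Ω] [MeasurableSpace Ω'] {α q ε δ : ℝ} {e : ℝ≥0∞}
  {μ ν : Measure Ω}

theorem RenyiBound.refl (hq : α.HolderConjugate q) (μ : Measure Ω) [IsProbabilityMeasure μ] :
    RenyiBound q 0 μ μ := fun u hu => by
  simpa using ENNReal.lintegral_mul_le_Lp_mul_Lq μ hq.symm hu.aemeasurable
    (aemeasurable_const (b := (1 : ℝ≥0∞)))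

theorem RenyiBound.mono {ε' : ℝ} (h : RenyiBound q ε μ ν) (hq : 0 < q) (hε : ε ≤ ε') :
    RenyiBound q ε' μ ν := fun u hu => (h u hu).trans (by gcongr)

theorem RenyiBound.prod (h : RenyiBound q ε μ ν) (hq : α.HolderConjugate q) [SFinite μ] [SFinite ν]
    (κ : Measure Ω') [IsProbabilityMeasure κ] : RenyiBound q ε (μ.prod κ) (ν.prod κ) := by
  intro u hu
  have hfiber : ∀ x, ∫⁻ y, u (x, y) ∂κ ≤ (∫⁻ y, u (x, y) ^ q ∂κ) ^ (1 / q) := fun x => by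
    simpa using RenyiBound.refl hq κ (fun y => u (x, y)) (hu.comp measurable_prodMk_left)
  rw [lintegral_prod _ hu.aemeasurable, lintegral_prod _ (hu.pow_const q).aemeasurable]
  refine (lintegral_mono hfiber).trans ?_
  refine (h _ ((hu.pow_const q).lintegral_prod_right'.pow_const _)).trans_eq ?_
  simp_rw [← ENNReal.rpow_mul, one_div_mul_cancel hq.symm.pos.ne', ENNReal.rpow_one]

theorem lintegral_add_gauss_le {d : ℕ} {σ : ℝ} (hσ : 0 < σ) (hq : α.HolderConjugate q) (a b : E d)
    {u : E d → ℝ≥0∞} (hu : Measurable u) :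
    ∫⁻ ζ, u (a + ζ) ∂gauss d σ ≤
      ENNReal.ofReal (Real.exp (α * ‖a - b‖ ^ 2 / (2 * σ ^ 2) / q)) *
        (∫⁻ ζ, u (b + ζ) ^ q ∂gauss d σ) ^ (1 / q) := by
  have hweight : (∫⁻ ζ, ENNReal.ofReal (weight σ (a - b) ζ) ^ α ∂gauss d σ) ^ (1 / α) =
      ENNReal.ofReal (Real.exp (α * ‖a - b‖ ^ 2 / (2 * σ ^ 2) / q)) := by
    rw [lintegral_weight_rpow hσ _ hq.pos.le, ENNReal.ofReal_rpow_of_pos (Real.exp_pos _),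
      ← Real.exp_mul, ← hq.div_conj_eq_sub_one]
    have := hq.pos.ne'
    congr 2
    field_simp
  calc ∫⁻ ζ, u (a + ζ) ∂gauss d σ
      = ∫⁻ ζ, u (b + ((a - b) + ζ)) ∂gauss d σ := by
        simp_rw [← add_assoc, add_sub_cancel]
    _ = ∫⁻ ζ, ENNReal.ofReal (weight σ (a - b) ζ) * u (b + ζ) ∂gauss d σ :=
        lintegral_gauss_shift hσ (a - b) (h := fun ζ => u (b + ζ)) (by fun_prop)
    _ ≤ _ := by
        rw [← hweight]
        exact ENNReal.lintegral_mul_le_Lp_mul_Lq _ hq (by fun_prop) (by fun_prop)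

theorem RenyiBound.add_gauss {d : ℕ} {σ : ℝ} (hσ : 0 < σ) (h : RenyiBound q ε μ ν)
    (hq : α.HolderConjugate q) [SFinite μ] [SFinite ν] {Δ : ℝ} {F F' : Ω → E d}
    (hF : Measurable F) (hF' : Measurable F') (hΔ : ∀ x, ‖F x - F' x‖ ≤ Δ) :
    RenyiBound q (ε + α * Δ ^ 2 / (2 * σ ^ 2))
      ((μ.prod (gauss d σ)).map fun p => F p.1 + p.2)
      ((ν.prod (gauss d σ)).map fun p => F' p.1 + p.2) := by
  intro u hu
  have hα := hq.pos
  have hq0 := hq.symm.pos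
  have hv : Measurable fun x => ∫⁻ ζ, u (F' x + ζ) ^ q ∂gauss d σ :=
    Measurable.lintegral_prod_right' (f := fun p : Ω × E d => u (F' p.1 + p.2) ^ q) (by fun_prop)
  rw [lintegral_map hu (by fun_prop), lintegral_map (hu.pow_const q) (by fun_prop),
    lintegral_prod _ (by fun_prop), lintegral_prod _ (by fun_prop)]
  calc ∫⁻ x, ∫⁻ ζ, u (F x + ζ) ∂gauss d σ ∂μ
      ≤ ∫⁻ x, ENNReal.ofReal (Real.exp (α * Δ ^ 2 / (2 * σ ^ 2) / q)) *
          (∫⁻ ζ, u (F' x + ζ) ^ q ∂gauss d σ) ^ (1 / q) ∂μ := by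
        refine lintegral_mono fun x => (lintegral_add_gauss_le hσ hq (F x) (F' x) hu).trans ?_
        gcongr
        exact hΔ x
    _ = ENNReal.ofReal (Real.exp (α * Δ ^ 2 / (2 * σ ^ 2) / q)) *
          ∫⁻ x, (∫⁻ ζ, u (F' x + ζ) ^ q ∂gauss d σ) ^ (1 / q) ∂μ :=
        lintegral_const_mul _ (hv.pow_const _)
    _ ≤ ENNReal.ofReal (Real.exp (α * Δ ^ 2 / (2 * σ ^ 2) / q)) *
          (ENNReal.ofReal (Real.exp (ε / q)) *
            (∫⁻ x, ∫⁻ ζ, u (F' x + ζ) ^ q ∂gauss d σ ∂ν) ^ (1 / q)) := by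
        gcongr
        refine (h _ (hv.pow_const _)).trans_eq ?_
        simp_rw [← ENNReal.rpow_mul, one_div_mul_cancel hq0.ne', ENNReal.rpow_one]
    _ = _ := by
        rw [← mul_assoc, ← ENNReal.ofReal_mul (Real.exp_pos _).le, ← Real.exp_add, ← add_div,
          add_comm ε]

theorem RenyiBound.absolutelyContinuous (h : RenyiBound q ε μ ν) (hq : 0 < q) : μ ≪ ν := by
  refine Measure.AbsolutelyContinuous.mk fun s hs hνs => ?_
  have hpow : ∀ x, (s.indicator (1 : Ω → ℝ≥0∞) x) ^ q = s.indicator 1 x := fun x => by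
    by_cases hx : x ∈ s <;> simp [hx, hq]
  have hle := h (s.indicator 1) (measurable_one.indicator hs)
  simp_rw [hpow, lintegral_indicator_one hs, hνs] at hle
  rwa [ENNReal.zero_rpow_of_pos (by positivity), mul_zero, nonpos_iff_eq_zero] at hle

theorem le_rpow_of_le_mul_rpow_conj (hq : α.HolderConjugate q) {I C : ℝ≥0∞} (hI : I ≠ ⊤)
    (h : I ≤ C * I ^ (1 / q)) : I ≤ C ^ α := by
  rcases eq_or_ne I 0 with rfl | hI0
  · exact bot_le
  have hsplit : I ^ (1 / α) * I ^ (1 / q) = I := by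
    rw [← ENNReal.rpow_add _ _ hI0 hI, one_div, one_div, hq.inv_add_inv_eq_one, ENNReal.rpow_one]
  have hne0 : I ^ (1 / q) ≠ 0 := (ENNReal.rpow_pos (pos_iff_ne_zero.2 hI0) hI).ne'
  have hnetop : I ^ (1 / q) ≠ ⊤ :=
    ENNReal.rpow_ne_top_of_nonneg (one_div_nonneg.2 hq.symm.pos.le) hI
  have hroot : I ^ (1 / α) ≤ C := by
    rwa [← ENNReal.mul_le_mul_iff_left hne0 hnetop, hsplit]
  calc I = (I ^ (1 / α)) ^ α := by
        rw [← ENNReal.rpow_mul, one_div_mul_cancel hq.pos.ne', ENNReal.rpow_one]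
    _ ≤ C ^ α := ENNReal.rpow_le_rpow hroot hq.pos.le

theorem lintegral_rpow_le_of_forall_min {f : Ω → ℝ≥0∞} (hf : Measurable f) (hα : 0 ≤ α)
    {C : ℝ≥0∞} (h : ∀ N : ℕ, ∫⁻ x, min (f x) N ^ α ∂ν ≤ C) : ∫⁻ x, f x ^ α ∂ν ≤ C := by
  refine le_of_tendsto' (lintegral_tendsto_of_tendsto_of_monotone
    (fun N : ℕ => ((hf.min measurable_const).pow_const α).aemeasurable) ?_ ?_) h
  · exact ae_of_all _ fun x N M hNM => by dsimp only; gcongr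
  · refine ae_of_all _ fun x => (ENNReal.continuous_rpow_const.tendsto _).comp ?_
    simpa using (tendsto_const_nhds (x := f x)).min ENNReal.tendsto_nat_nhds_top

/-- The extremal test function in the dual formulation is the power `α - 1` of the density; it is
truncated to be integrable. -/
theorem RenyiBound.lintegral_min_rnDeriv_rpow_le [SigmaFinite μ] [IsFiniteMeasure ν]
    (h : RenyiBound q ε μ ν) (hq : α.HolderConjugate q) (N : ℕ) :
    ∫⁻ x, min (μ.rnDeriv ν x) N ^ α ∂ν ≤ ENNReal.ofReal (Real.exp (ε / q)) ^ α := by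
  set f := μ.rnDeriv ν
  have hf : Measurable f := Measure.measurable_rnDeriv μ ν
  have hfinite : ∫⁻ x, min (f x) N ^ α ∂ν ≠ ⊤ := by
    have hN : (N : ℝ≥0∞) ^ α ≠ ⊤ :=
      ENNReal.rpow_ne_top_of_nonneg hq.pos.le (ENNReal.natCast_ne_top N)
    refine ne_top_of_le_ne_top (b := (N : ℝ≥0∞) ^ α * ν Set.univ) (by finiteness) ?_
    exact (lintegral_mono fun x => ENNReal.rpow_le_rpow (min_le_right _ _) hq.pos.le).trans_eq
      (lintegral_const _)
  have hdensity : ∫⁻ x, min (f x) N ^ α ∂ν ≤ ∫⁻ x, min (f x) N ^ (α - 1) ∂μ := by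
    rw [← Measure.withDensity_rnDeriv_eq μ ν (h.absolutelyContinuous hq.symm.pos),
      lintegral_withDensity_eq_lintegral_mul _ hf (by fun_prop)]
    refine lintegral_mono fun x => ?_
    calc min (f x) N ^ α = min (f x) N ^ (1 : ℝ) * min (f x) N ^ (α - 1) := by
          rw [← ENNReal.rpow_add_of_nonneg _ _ zero_le_one hq.sub_one_pos.le, add_sub_cancel]
      _ ≤ f x * min (f x) N ^ (α - 1) := by
          rw [ENNReal.rpow_one]
          gcongr
          exact min_le_left _ _
  have hdual := h (fun x => min (f x) N ^ (α - 1)) (by fun_prop)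
  simp_rw [← ENNReal.rpow_mul, hq.sub_one_mul_conj] at hdual
  exact le_rpow_of_le_mul_rpow_conj hq hfinite (hdensity.trans hdual)

theorem RenyiBound.lintegral_rnDeriv_rpow_le [SigmaFinite μ] [IsFiniteMeasure ν]
    (h : RenyiBound q ε μ ν) (hq : α.HolderConjugate q) :
    ∫⁻ x, μ.rnDeriv ν x ^ α ∂ν ≤ ENNReal.ofReal (Real.exp (ε * (α - 1))) := by
  refine (lintegral_rpow_le_of_forall_min (Measure.measurable_rnDeriv μ ν) hq.pos.le
    (h.lintegral_min_rnDeriv_rpow_le hq)).trans_eq ?_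
  rw [ENNReal.ofReal_rpow_of_pos (Real.exp_pos _), ← Real.exp_mul, ← hq.div_conj_eq_sub_one,
    div_mul_eq_mul_div, mul_div_assoc]

theorem RenyiBound.renyiDiv_le [SigmaFinite μ] [IsFiniteMeasure ν] (h : RenyiBound q ε μ ν)
    (hq : α.HolderConjugate q) : renyiDiv α μ ν ≤ (ε : EReal) := by
  have hα := hq.sub_one_pos
  have hlog := ENNReal.log_monotone (h.lintegral_rnDeriv_rpow_le hq)
  rw [← EReal.exp_coe, EReal.log_exp] at hlog
  rw [renyiDiv, if_pos (h.absolutelyContinuous hq.symm.pos)]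
  calc ((1 / (α - 1) : ℝ) : EReal) * ENNReal.log (∫⁻ ω, μ.rnDeriv ν ω ^ α ∂ν)
      ≤ ((1 / (α - 1) : ℝ) : EReal) * ((ε * (α - 1) : ℝ) : EReal) :=
        mul_le_mul_of_nonneg_left hlog (EReal.coe_nonneg.2 (by positivity))
    _ = (ε : EReal) := by
        rw [← EReal.coe_mul]
        congr 1
        field_simp

theorem TVBound.refl (μ : Measure Ω) : TVBound 0 μ μ := fun u _ _ => by rw [add_zero]

theorem TVBound.mono {e' : ℝ≥0∞} (h : TVBound e μ ν) (he : e ≤ e') : TVBound e' μ ν :=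
  fun u hu hu1 => (h u hu hu1).trans (by gcongr)

theorem TVBound.trans {τ : Measure Ω} {e' : ℝ≥0∞} (h : TVBound e μ ν) (h' : TVBound e' ν τ) :
    TVBound (e + e') μ τ := fun u hu hu1 => by
  calc ∫⁻ x, u x ∂μ ≤ ∫⁻ x, u x ∂ν + e := h u hu hu1
    _ ≤ ∫⁻ x, u x ∂τ + e' + e := by gcongr; exact h' u hu hu1
    _ = _ := by rw [add_assoc, add_comm e']

theorem TVBound.prod (h : TVBound e μ ν) [SFinite μ] [SFinite ν] (κ : Measure Ω')
    [IsProbabilityMeasure κ] : TVBound e (μ.prod κ) (ν.prod κ) := by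
  intro u hu hu1
  rw [lintegral_prod _ hu.aemeasurable, lintegral_prod _ hu.aemeasurable]
  exact h _ hu.lintegral_prod_right' fun x =>
    (lintegral_mono fun y => hu1 (x, y)).trans (by simp)

theorem TVBound.map (h : TVBound e μ ν) {f : Ω → Ω'} (hf : Measurable f) :
    TVBound e (μ.map f) (ν.map f) := by
  intro u hu hu1
  rw [lintegral_map hu hf, lintegral_map hu hf]
  exact h _ (hu.comp hf) fun x => hu1 _

theorem tvBound_map_of_coupling {f g : Ω → Ω'} (hf : Measurable f) (hg : Measurable g) :
    TVBound (μ {x | f x ≠ g x}) (μ.map f) (μ.map g) := by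
  intro u hu hu1
  rw [lintegral_map hu hf, lintegral_map hu hg]
  calc ∫⁻ x, u (f x) ∂μ
      ≤ ∫⁻ x, u (g x) + (toMeasurable μ {x | f x ≠ g x}).indicator 1 x ∂μ := by
        refine lintegral_mono fun x => ?_
        by_cases hx : f x = g x
        · exact hx ▸ le_self_add
        · have hmem : x ∈ toMeasurable μ {x | f x ≠ g x} := subset_toMeasurable μ _ hx
          rw [Set.indicator_of_mem hmem]
          exact (hu1 _).trans le_add_self
    _ = _ := by
        rw [lintegral_add_left (by fun_prop),
          lintegral_indicator_one (measurableSet_toMeasurable _ _), measure_toMeasurable]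

theorem exists_tvDist_eq_measureReal_sub (μ ν : Measure Ω) [IsProbabilityMeasure μ]
    [IsProbabilityMeasure ν] : ∃ A, MeasurableSet A ∧ tvDist μ ν = μ.real A - ν.real A := by
  have hμ : μ ≪ μ + ν := Measure.absolutelyContinuous_of_le (Measure.le_add_right le_rfl)
  have hν : ν ≪ μ + ν := Measure.absolutelyContinuous_of_le (Measure.le_add_left le_rfl)
  set f := fun ω => (μ.rnDeriv (μ + ν) ω).toReal
  set g := fun ω => (ν.rnDeriv (μ + ν) ω).toReal
  have hfi : Integrable f (μ + ν) := Measure.integrable_toReal_rnDeriv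
  have hgi : Integrable g (μ + ν) := Measure.integrable_toReal_rnDeriv
  have hA : MeasurableSet {ω | g ω ≤ f ω} :=
    measurableSet_le (Measure.measurable_rnDeriv _ _).ennreal_toReal
      (Measure.measurable_rnDeriv _ _).ennreal_toReal
  refine ⟨_, hA, ?_⟩
  set A := {ω | g ω ≤ f ω}
  have hpos : ∫ ω in A, |f ω - g ω| ∂(μ + ν) = μ.real A - ν.real A := by
    rw [← Measure.setIntegral_toReal_rnDeriv hμ, ← Measure.setIntegral_toReal_rnDeriv hν,
      ← integral_sub hfi.integrableOn hgi.integrableOn]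
    exact setIntegral_congr_fun hA fun ω hω => abs_of_nonneg (sub_nonneg.2 hω)
  have hneg : ∫ ω in Aᶜ, |f ω - g ω| ∂(μ + ν) = ν.real Aᶜ - μ.real Aᶜ := by
    rw [← Measure.setIntegral_toReal_rnDeriv hμ, ← Measure.setIntegral_toReal_rnDeriv hν,
      ← integral_sub hgi.integrableOn hfi.integrableOn]
    refine setIntegral_congr_fun hA.compl fun ω hω => ?_
    exact (abs_sub_comm _ _).trans (abs_of_nonneg (sub_nonneg.2 (le_of_not_ge hω)))
  change 1 / 2 * ∫ ω, |f ω - g ω| ∂(μ + ν) = _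
  rw [← integral_add_compl (f := fun ω => |f ω - g ω|) hA (hfi.sub hgi).abs, hpos, hneg,
    probReal_compl_eq_one_sub hA, probReal_compl_eq_one_sub hA]
  ring

theorem TVBound.tvDist_le [IsProbabilityMeasure μ] [IsProbabilityMeasure ν] (hδ : 0 ≤ δ)
    (h : TVBound (ENNReal.ofReal δ) μ ν) : tvDist μ ν ≤ δ := by
  obtain ⟨A, hA, htv⟩ := exists_tvDist_eq_measureReal_sub μ ν
  have hle := h (A.indicator 1) (measurable_one.indicator hA)
    (fun x => Set.indicator_le_self' (by simp) x)
  rw [lintegral_indicator_one hA, lintegral_indicator_one hA] at hle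
  have hreal := ENNReal.toReal_mono (by finiteness) hle
  rw [ENNReal.toReal_add (by finiteness) (by finiteness), ENNReal.toReal_ofReal hδ] at hreal
  rw [htv, sub_le_iff_le_add']
  exact hreal

theorem RenyiBound.approxRenyiDiv_le_and_exists {μ' ν' : Measure Ω} [IsProbabilityMeasure μ]
    [IsProbabilityMeasure ν] [IsProbabilityMeasure μ'] [IsProbabilityMeasure ν']
    (hq : α.HolderConjugate q) (hδ : 0 ≤ δ) (h : RenyiBound q ε μ' ν')
    (hμ : TVBound (ENNReal.ofReal δ) μ' μ) (hν : TVBound (ENNReal.ofReal δ) ν' ν) :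
    approxRenyiDiv α δ μ ν ≤ (ε : EReal) ∧
      ∃ μ' ν' : ProbabilityMeasure Ω, tvDist (μ' : Measure Ω) μ ≤ δ ∧
        tvDist (ν' : Measure Ω) ν ≤ δ ∧
        renyiDiv α (μ' : Measure Ω) (ν' : Measure Ω) ≤ (ε : EReal) := by
  let M : ProbabilityMeasure Ω := ⟨μ', inferInstance⟩
  let N : ProbabilityMeasure Ω := ⟨ν', inferInstance⟩
  have hM : tvDist (M : Measure Ω) μ ≤ δ := hμ.tvDist_le hδ
  have hN : tvDist (N : Measure Ω) ν ≤ δ := hν.tvDist_le hδ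
  have hMN : renyiDiv α (M : Measure Ω) (N : Measure Ω) ≤ (ε : EReal) := h.renyiDiv_le hq
  exact ⟨iInf_le_of_le M (iInf_le_of_le N (iInf_le_of_le hM (iInf_le_of_le hN hMN))),
    M, N, hM, hN, hMN⟩

theorem tvBound_midpoint (μ ν : Measure Ω) [IsProbabilityMeasure ν] :
    TVBound 2⁻¹ ((2⁻¹ : ℝ≥0∞) • (μ + ν)) μ := by
  intro u _ hu1
  rw [lintegral_smul_measure, lintegral_add_measure, smul_eq_mul, mul_add]
  refine add_le_add (mul_le_of_le_one_left' (by simp)) ?_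
  exact mul_le_of_le_one_right' ((lintegral_mono hu1).trans (by simp))

theorem isProbabilityMeasure_midpoint (μ ν : Measure Ω) [IsProbabilityMeasure μ]
    [IsProbabilityMeasure ν] : IsProbabilityMeasure ((2⁻¹ : ℝ≥0∞) • (μ + ν)) where
  measure_univ := by
    rw [Measure.smul_apply, Measure.add_apply, measure_univ, measure_univ, smul_eq_mul,
      one_add_one_eq_two, ENNReal.inv_mul_cancel two_ne_zero ENNReal.ofNat_ne_top]

end Divergences

section MomentContraction

theorem one_add_pow_le_quadratic {y : ℝ} (hy : -1 ≤ y) (m : ℕ) :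
    (1 + y) ^ m ≤ 1 + m * y + m ^ 2 * y ^ 2 * (1 + |y|) ^ m := by
  induction m with
  | zero => simp
  | succ m ih =>
    have h_linear : (m : ℝ) * y ^ 2 ≤ m * y ^ 2 * (1 + |y|) ^ (m + 1) :=
      le_mul_of_one_le_right (by positivity) (one_le_pow₀ (by linarith [abs_nonneg y]))
    have h_quadratic : (m : ℝ) ^ 2 * y ^ 2 * (1 + |y|) ^ m * (1 + y) ≤
        m ^ 2 * y ^ 2 * (1 + |y|) ^ (m + 1) := by
      rw [pow_succ _ m, ← mul_assoc]
      gcongr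
      exact le_abs_self y
    have h_coeff : ((m : ℝ) + m ^ 2) * (y ^ 2 * (1 + |y|) ^ (m + 1)) ≤
        (m + 1) ^ 2 * (y ^ 2 * (1 + |y|) ^ (m + 1)) := by
      gcongr
      nlinarith [(Nat.cast_nonneg m : (0 : ℝ) ≤ m)]
    have h_step := mul_le_mul_of_nonneg_right ih (by linarith : 0 ≤ 1 + y)
    rw [pow_succ]
    push_cast
    linarith

theorem one_sub_two_mul_add_sq_pow_le {a t : ℝ} (ha : |a| ≤ t) (m : ℕ) :
    (1 - 2 * a + t ^ 2) ^ m ≤ 1 - 2 * m * a + 5 * m ^ 2 * (t ^ 2 * (1 + t) ^ (2 * m + 2)) := by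
  have ht : 0 ≤ t := (abs_nonneg a).trans ha
  obtain ⟨ha_lower, ha_upper⟩ := abs_le.1 ha
  set y := -2 * a + t ^ 2 with hy
  have hy_lower : -1 ≤ y := by nlinarith [sq_nonneg (t - 1)]
  have hy_abs : |y| ≤ 2 * t + t ^ 2 := abs_le.2 ⟨by nlinarith, by linarith⟩
  have hy_sq : y ^ 2 ≤ 4 * t ^ 2 * (1 + t) ^ 2 :=
    calc y ^ 2 = |y| ^ 2 := (sq_abs y).symm
      _ ≤ (2 * t * (1 + t)) ^ 2 := by gcongr; nlinarith
      _ = 4 * t ^ 2 * (1 + t) ^ 2 := by ring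
  have hy_pow : (1 + |y|) ^ m ≤ (1 + t) ^ (2 * m) := by
    rw [pow_mul]
    gcongr
    linarith
  have h_remainder : (m : ℝ) ^ 2 * y ^ 2 * (1 + |y|) ^ m ≤
      4 * m ^ 2 * (t ^ 2 * (1 + t) ^ (2 * m + 2)) :=
    calc (m : ℝ) ^ 2 * y ^ 2 * (1 + |y|) ^ m
        ≤ m ^ 2 * (4 * t ^ 2 * (1 + t) ^ 2) * (1 + t) ^ (2 * m) := by gcongr
      _ = 4 * m ^ 2 * (t ^ 2 * (1 + t) ^ (2 * m + 2)) := by ring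
  have h_linear : (m : ℝ) * t ^ 2 ≤ m ^ 2 * (t ^ 2 * (1 + t) ^ (2 * m + 2)) := by
    gcongr
    · exact_mod_cast Nat.le_self_pow two_ne_zero m
    · exact le_mul_of_one_le_right (by positivity) (one_le_pow₀ (by linarith))
  calc (1 - 2 * a + t ^ 2) ^ m = (1 + y) ^ m := by rw [hy]; ring
    _ ≤ 1 + m * y + m ^ 2 * y ^ 2 * (1 + |y|) ^ m := one_add_pow_le_quadratic hy_lower m
    _ ≤ _ := by rw [hy] at h_remainder ⊢; linarith

variable {F : Type*} [NormedAddCommGroup F] [InnerProductSpace ℝ F]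

theorem norm_sub_pow_le {x a : F} (hx : x ≠ 0) {D : ℝ} (ha : ‖a‖ ≤ D * ‖x‖) (m : ℕ) :
    ‖x - a‖ ^ (2 * m) ≤ ‖x‖ ^ (2 * m) *
      (1 - 2 * m * (inner ℝ x a / ‖x‖ ^ 2) + 5 * m ^ 2 * (D ^ 2 * (1 + D) ^ (2 * m + 2))) := by
  have hx_pos : 0 < ‖x‖ := norm_pos_iff.2 hx
  have h_ratio : ‖a‖ / ‖x‖ ≤ D := (div_le_iff₀ hx_pos).2 ha
  have h_inner : |inner ℝ x a / ‖x‖ ^ 2| ≤ ‖a‖ / ‖x‖ := by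
    rw [abs_div, abs_of_nonneg (sq_nonneg ‖x‖), div_le_div_iff₀ (by positivity) hx_pos]
    nlinarith [abs_real_inner_le_norm x a]
  have h_sq : ‖x - a‖ ^ 2 =
      ‖x‖ ^ 2 * (1 - 2 * (inner ℝ x a / ‖x‖ ^ 2) + (‖a‖ / ‖x‖) ^ 2) := by
    rw [norm_sub_sq_real]
    field_simp
  rw [pow_mul, h_sq, mul_pow, ← pow_mul]
  gcongr
  exact (one_sub_two_mul_add_sq_pow_le h_inner m).trans (by gcongr)

theorem lintegral_enorm_sub_pow_le {Ω : Type*} [MeasurableSpace Ω] {μ : Measure Ω}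
    [IsProbabilityMeasure μ] {x : F} {A : Ω → F} {D : Ω → ℝ} (m : ℕ)
    (hA : ∀ ω, ‖A ω‖ ≤ D ω * ‖x‖) (hA_int : Integrable (fun ω => inner ℝ x (A ω)) μ)
    (hA_mean : 0 ≤ ∫ ω, inner ℝ x (A ω) ∂μ)
    (hD : Integrable (fun ω => D ω ^ 2 * (1 + D ω) ^ (2 * m + 2)) μ) :
    ∫⁻ ω, ‖x - A ω‖ₑ ^ (2 * m) ∂μ ≤
      ENNReal.ofReal (1 + 5 * m ^ 2 * ∫ ω, D ω ^ 2 * (1 + D ω) ^ (2 * m + 2) ∂μ) *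
        ‖x‖ₑ ^ (2 * m) := by
  rcases eq_or_ne x 0 with rfl | hx
  · have hA_zero : ∀ ω, A ω = 0 := fun ω => by simpa using hA ω
    have h_nonneg : 0 ≤ ∫ ω, D ω ^ 2 * (1 + D ω) ^ (2 * m + 2) ∂μ :=
      integral_nonneg fun ω => mul_nonneg (sq_nonneg _) (Even.pow_nonneg ⟨m + 1, by ring⟩ _)
    simp only [hA_zero, sub_zero, lintegral_const, measure_univ, mul_one]
    exact le_mul_of_one_le_left' (ENNReal.one_le_ofReal.2 (le_add_of_nonneg_right (by positivity)))
  set N : Ω → ℝ := fun ω => 1 - 2 * m * (inner ℝ x (A ω) / ‖x‖ ^ 2)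
  set B : Ω → ℝ := fun ω => D ω ^ 2 * (1 + D ω) ^ (2 * m + 2)
  have h_pointwise : ∀ ω, ‖x - A ω‖ ^ (2 * m) ≤ ‖x‖ ^ (2 * m) * (N ω + 5 * m ^ 2 * B ω) :=
    fun ω => norm_sub_pow_le hx (hA ω) m
  have hN_int : Integrable N μ :=
    (integrable_const 1).sub ((hA_int.div_const _).const_mul _)
  have hN_mean : ∫ ω, N ω ∂μ ≤ 1 := by
    rw [integral_sub (integrable_const 1) ((hA_int.div_const _).const_mul _), integral_const_mul,
      integral_div, integral_const, probReal_univ, one_smul, sub_le_self_iff]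
    positivity
  have h_int : Integrable (fun ω => ‖x‖ ^ (2 * m) * (N ω + 5 * m ^ 2 * B ω)) μ :=
    (hN_int.add (hD.const_mul _)).const_mul _
  calc ∫⁻ ω, ‖x - A ω‖ₑ ^ (2 * m) ∂μ
      = ∫⁻ ω, ENNReal.ofReal (‖x - A ω‖ ^ (2 * m)) ∂μ := by
        simp only [ENNReal.ofReal_pow (norm_nonneg _), ofReal_norm]
    _ ≤ ∫⁻ ω, ENNReal.ofReal (‖x‖ ^ (2 * m) * (N ω + 5 * m ^ 2 * B ω)) ∂μ := by
        gcongr with ω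
        exact h_pointwise ω
    _ = ENNReal.ofReal (∫ ω, ‖x‖ ^ (2 * m) * (N ω + 5 * m ^ 2 * B ω) ∂μ) :=
        (ofReal_integral_eq_lintegral_ofReal h_int
          (ae_of_all _ fun ω => (by positivity : (0 : ℝ) ≤ _).trans (h_pointwise ω))).symm
    _ ≤ ENNReal.ofReal ((1 + 5 * m ^ 2 * ∫ ω, B ω ∂μ) * ‖x‖ ^ (2 * m)) := by
        rw [integral_const_mul, integral_add hN_int (hD.const_mul _), integral_const_mul, mul_comm]
        gcongr
    _ = _ := by
        rw [ENNReal.ofReal_mul' (by positivity), ENNReal.ofReal_pow (norm_nonneg _), ofReal_norm]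

end MomentContraction

section WeightDifference

variable {d : ℕ} {σ : ℝ}

theorem abs_exp_sub_exp_le {x y c : ℝ} (hx : x ≤ c) (hy : y ≤ c) :
    |Real.exp x - Real.exp y| ≤ |x - y| * Real.exp c := by
  wlog h : y ≤ x generalizing x y
  · rw [abs_sub_comm, abs_sub_comm x]
    exact this hy hx (le_of_not_ge h)
  rw [abs_of_nonneg (sub_nonneg.2 (Real.exp_le_exp.2 h)), abs_of_nonneg (sub_nonneg.2 h)]
  calc Real.exp x - Real.exp y = Real.exp x * (1 - Real.exp (y - x)) := by
        rw [mul_sub, mul_one, ← Real.exp_add, add_sub_cancel]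
    _ ≤ Real.exp c * (x - y) :=
        mul_le_mul (Real.exp_le_exp.2 hx) (by linarith [Real.add_one_le_exp (y - x)])
          (sub_nonneg.2 (Real.exp_le_one_iff.2 (sub_nonpos.2 h))) (Real.exp_pos c).le
    _ = (x - y) * Real.exp c := mul_comm _ _

theorem abs_weight_sub_le (hσ : 0 < σ) {R : ℝ} {v v' : E d} (hv : ‖v‖ ≤ R) (hv' : ‖v'‖ ≤ R)
    (ξ : E d) :
    |weight σ v ξ - weight σ v' ξ| ≤ (|inner ℝ (v - v') ξ| + R * ‖v - v'‖) / σ ^ 2 *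
      Real.exp ((|inner ℝ v ξ| + |inner ℝ v' ξ|) / σ ^ 2) := by
  have h_sq : |(‖v‖ ^ 2 - ‖v'‖ ^ 2) / 2| ≤ R * ‖v - v'‖ :=
    calc |(‖v‖ ^ 2 - ‖v'‖ ^ 2) / 2| = (‖v‖ + ‖v'‖) / 2 * |‖v‖ - ‖v'‖| := by
          rw [← abs_of_nonneg (by positivity : 0 ≤ (‖v‖ + ‖v'‖) / 2), ← abs_mul]
          ring_nf
      _ ≤ R * ‖v - v'‖ :=
          mul_le_mul (by linarith) (abs_norm_sub_norm_le v v') (abs_nonneg _)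
            ((norm_nonneg v).trans hv)
  rw [weight_eq_exp hσ, weight_eq_exp hσ]
  refine (abs_exp_sub_exp_le (c := (|inner ℝ v ξ| + |inner ℝ v' ξ|) / σ ^ 2) ?_ ?_).trans ?_
  · gcongr
    linarith [le_abs_self (inner ℝ v ξ), abs_nonneg (inner ℝ v' ξ), sq_nonneg ‖v‖]
  · gcongr
    linarith [le_abs_self (inner ℝ v' ξ), abs_nonneg (inner ℝ v ξ), sq_nonneg ‖v'‖]
  · rw [← sub_div, abs_div, abs_of_nonneg (sq_nonneg σ)]
    gcongr
    calc |inner ℝ v ξ - ‖v‖ ^ 2 / 2 - (inner ℝ v' ξ - ‖v'‖ ^ 2 / 2)|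
        = |inner ℝ (v - v') ξ - (‖v‖ ^ 2 - ‖v'‖ ^ 2) / 2| := by rw [inner_sub_left]; ring_nf
      _ ≤ |inner ℝ (v - v') ξ| + R * ‖v - v'‖ := (abs_sub _ _).trans (by gcongr)

theorem sq_mul_one_add_pow_le_exp {κ s γ D : ℝ} (m : ℕ) (hκ : 0 ≤ κ)
    (hκm : κ * (2 * m + 2) ≤ 1 / 4) (hs : 0 ≤ s) (hγ : 0 ≤ γ) (hD0 : 0 ≤ D)
    (hD : D ≤ κ * s * Real.exp γ) :
    D ^ 2 * (1 + D) ^ (2 * m + 2) ≤ 2 * κ ^ 2 * Real.exp (5 / 4 * s + (2 * m + 4) * γ) := by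
  have h_one_add : 1 + D ≤ Real.exp (κ * s + γ) := by
    rw [Real.exp_add]
    nlinarith [Real.add_one_le_exp (κ * s), Real.one_le_exp hγ, mul_nonneg hκ hs]
  have h_sq : s ^ 2 ≤ 2 * Real.exp s := by linarith [Real.quadratic_le_exp_of_nonneg hs]
  calc D ^ 2 * (1 + D) ^ (2 * m + 2)
      ≤ (κ * s * Real.exp γ) ^ 2 * Real.exp (κ * s + γ) ^ (2 * m + 2) := by gcongr
    _ = κ ^ 2 * s ^ 2 * (Real.exp γ ^ 2 * Real.exp (κ * s + γ) ^ (2 * m + 2)) := by ring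
    _ ≤ κ ^ 2 * (2 * Real.exp s) * (Real.exp γ ^ 2 * Real.exp (κ * s + γ) ^ (2 * m + 2)) := by
        gcongr
    _ = 2 * κ ^ 2 * Real.exp (s + κ * (2 * m + 2) * s + (2 * m + 4) * γ) := by
        rw [← Real.exp_nat_mul, ← Real.exp_nat_mul, ← Real.exp_add, mul_assoc, mul_assoc,
          ← Real.exp_add]
        push_cast
        ring_nf
    _ ≤ 2 * κ ^ 2 * Real.exp (5 / 4 * s + (2 * m + 4) * γ) := by
        gcongr
        nlinarith [mul_le_mul_of_nonneg_right hκm hs]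

theorem exp_three_halves_le : Real.exp (3 / 2) ≤ 6 := by
  have h_sq : Real.exp (3 / 2) ^ 2 = Real.exp 1 ^ 3 := by
    rw [← Real.exp_nat_mul, ← Real.exp_nat_mul]
    norm_num
  have h_cube : Real.exp 1 ^ 3 ≤ 2.72 ^ 3 := by
    gcongr
    linarith [Real.exp_one_lt_d9]
  nlinarith [Real.exp_pos (3 / 2)]

theorem lintegral_exp_three_abs_inner_le (hσ : 0 < σ) {a b c : E d} {s : ℝ}
    (hs : σ * ‖a‖ + σ * ‖b‖ + σ * ‖c‖ ≤ s) :
    ∫⁻ ξ, ENNReal.ofReal (Real.exp (|inner ℝ a ξ| + |inner ℝ b ξ| + |inner ℝ c ξ|)) ∂gauss d σ ≤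
      ENNReal.ofReal (8 * Real.exp (s ^ 2 / 2)) := by
  have h := lintegral_exp_sum_abs_inner_le hσ ![a, b, c] Finset.univ 0
  simp only [inner_zero_left, zero_add, norm_zero, Fin.sum_univ_three, Matrix.cons_val,
    Finset.card_univ, Fintype.card_fin] at h
  refine h.trans ?_
  rw [show (2 : ℝ≥0∞) ^ 3 = ENNReal.ofReal 8 by norm_num, ← ENNReal.ofReal_mul (by norm_num),
    ← mul_pow, mul_add, mul_add]
  gcongr

/-- The size, relative to `‖v - v'‖`, of `κ σ` times the difference of the weights of `v` and
`v'`. -/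
noncomputable def relWeightDiff (κ σ : ℝ) (v v' ξ : E d) : ℝ :=
  κ * σ * |weight σ v ξ - weight σ v' ξ| / ‖v - v'‖

theorem measurable_relWeightDiff (κ σ : ℝ) (v v' : E d) :
    Measurable (relWeightDiff κ σ v v') := by
  unfold relWeightDiff
  fun_prop

theorem relWeightDiff_nonneg {κ : ℝ} (hκ : 0 ≤ κ) (hσ : 0 < σ) (v v' ξ : E d) :
    0 ≤ relWeightDiff κ σ v v' ξ := by
  unfold relWeightDiff
  positivity

variable {κ R : ℝ} {v v' : E d}

theorem relWeightDiff_le (hκ : 0 ≤ κ) (hσ : 0 < σ) (hv : ‖v‖ ≤ R) (hv' : ‖v'‖ ≤ R)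
    (hne : v ≠ v') (ξ : E d) :
    relWeightDiff κ σ v v' ξ ≤ κ * (|inner ℝ (v - v') ξ| / (σ * ‖v - v'‖) + R / σ) *
      Real.exp ((|inner ℝ v ξ| + |inner ℝ v' ξ|) / σ ^ 2) := by
  have h_pos : 0 < ‖v - v'‖ := norm_pos_iff.2 (sub_ne_zero.2 hne)
  calc relWeightDiff κ σ v v' ξ
      ≤ κ * σ * ((|inner ℝ (v - v') ξ| + R * ‖v - v'‖) / σ ^ 2 *
          Real.exp ((|inner ℝ v ξ| + |inner ℝ v' ξ|) / σ ^ 2)) / ‖v - v'‖ := by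
        unfold relWeightDiff
        gcongr
        exact abs_weight_sub_le hσ hv hv' ξ
    _ = _ := by field_simp

theorem relWeightDiff_sq_mul_one_add_pow_le (m : ℕ) (hκ : 0 ≤ κ) (hσ : 0 < σ)
    (hκm : κ * (2 * m + 2) ≤ 1 / 4) (hv : ‖v‖ ≤ R) (hv' : ‖v'‖ ≤ R) (hne : v ≠ v') (ξ : E d) :
    relWeightDiff κ σ v v' ξ ^ 2 * (1 + relWeightDiff κ σ v v' ξ) ^ (2 * m + 2) ≤
      2 * κ ^ 2 * Real.exp (5 / 4 * (R / σ)) * Real.exp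
        (|inner ℝ ((5 / 4 / (σ * ‖v - v'‖)) • (v - v')) ξ| +
          |inner ℝ (((2 * m + 4) / σ ^ 2) • v) ξ| + |inner ℝ (((2 * m + 4) / σ ^ 2) • v') ξ|) := by
  have hR : 0 ≤ R := (norm_nonneg v).trans hv
  refine (sq_mul_one_add_pow_le_exp m hκ hκm (by positivity) (by positivity)
    (relWeightDiff_nonneg hκ hσ v v' ξ) (relWeightDiff_le hκ hσ hv hv' hne ξ)).trans_eq ?_
  have h_coeff : ∀ (c : ℝ) (w : E d), 0 ≤ c → |inner ℝ (c • w) ξ| = c * |inner ℝ w ξ| :=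
    fun c w hc => by rw [real_inner_smul_left, abs_mul, abs_of_nonneg hc]
  rw [h_coeff _ _ (by positivity), h_coeff _ _ (by positivity), h_coeff _ _ (by positivity),
    mul_assoc (2 * κ ^ 2), ← Real.exp_add]
  ring_nf

theorem lintegral_relWeightDiff_sq_mul_one_add_pow_le (m : ℕ) (hκ : 0 ≤ κ) (hσ : 0 < σ)
    (hκm : κ * (2 * m + 2) ≤ 1 / 4) (hRm : (2 * m + 4) * (R / σ) ≤ 1 / 6) (hv : ‖v‖ ≤ R)
    (hv' : ‖v'‖ ≤ R) :
    ∫⁻ ξ, ENNReal.ofReal (relWeightDiff κ σ v v' ξ ^ 2 *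
      (1 + relWeightDiff κ σ v v' ξ) ^ (2 * m + 2)) ∂gauss d σ ≤ ENNReal.ofReal (100 * κ ^ 2) := by
  rcases eq_or_ne v v' with rfl | hne
  · simp [relWeightDiff]
  have h_pos : 0 < ‖v - v'‖ := norm_pos_iff.2 (sub_ne_zero.2 hne)
  have hR : 0 ≤ R := (norm_nonneg v).trans hv
  have h_diff : σ * ‖(5 / 4 / (σ * ‖v - v'‖)) • (v - v')‖ = 5 / 4 := by
    rw [norm_smul_of_nonneg (by positivity)]
    field_simp
  have h_center : ∀ w : E d, ‖w‖ ≤ R → σ * ‖((2 * m + 4) / σ ^ 2) • w‖ ≤ 1 / 6 := fun w hw =>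
    calc σ * ‖((2 * m + 4) / σ ^ 2) • w‖ = σ * ((2 * m + 4) / σ ^ 2 * ‖w‖) := by
          rw [norm_smul_of_nonneg (by positivity)]
      _ ≤ σ * ((2 * m + 4) / σ ^ 2 * R) := by gcongr
      _ = (2 * m + 4) * (R / σ) := by field_simp
      _ ≤ 1 / 6 := hRm
  have hRσ : R / σ ≤ 1 / 24 := by
    nlinarith [(Nat.cast_nonneg m : (0 : ℝ) ≤ m), div_nonneg hR hσ.le]
  calc _ ≤ ∫⁻ ξ, ENNReal.ofReal (2 * κ ^ 2 * Real.exp (5 / 4 * (R / σ))) * ENNReal.ofReal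
        (Real.exp (|inner ℝ ((5 / 4 / (σ * ‖v - v'‖)) • (v - v')) ξ| +
          |inner ℝ (((2 * m + 4) / σ ^ 2) • v) ξ| + |inner ℝ (((2 * m + 4) / σ ^ 2) • v') ξ|))
        ∂gauss d σ := by
        gcongr with ξ
        rw [← ENNReal.ofReal_mul (by positivity)]
        exact ENNReal.ofReal_le_ofReal
          (relWeightDiff_sq_mul_one_add_pow_le m hκ hσ hκm hv hv' hne ξ)
    _ ≤ ENNReal.ofReal (2 * κ ^ 2 * Real.exp (5 / 4 * (R / σ))) *
        ENNReal.ofReal (8 * Real.exp ((19 / 12) ^ 2 / 2)) := by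
        rw [lintegral_const_mul _ (by fun_prop)]
        gcongr
        exact lintegral_exp_three_abs_inner_le hσ
          (by linarith [h_diff, h_center v hv, h_center v' hv'])
    _ = ENNReal.ofReal (16 * κ ^ 2 * Real.exp (5 / 4 * (R / σ) + (19 / 12) ^ 2 / 2)) := by
        rw [← ENNReal.ofReal_mul (by positivity), Real.exp_add]
        ring_nf
    _ ≤ ENNReal.ofReal (16 * κ ^ 2 * Real.exp (3 / 2)) := by
        gcongr
        linarith
    _ ≤ ENNReal.ofReal (100 * κ ^ 2) :=
        ENNReal.ofReal_le_ofReal (by nlinarith [exp_three_halves_le, sq_nonneg κ])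

theorem integrable_relWeightDiff_sq_mul_one_add_pow (m : ℕ) (hκ : 0 ≤ κ) (hσ : 0 < σ)
    (hκm : κ * (2 * m + 2) ≤ 1 / 4) (hRm : (2 * m + 4) * (R / σ) ≤ 1 / 6) (hv : ‖v‖ ≤ R)
    (hv' : ‖v'‖ ≤ R) :
    Integrable (fun ξ => relWeightDiff κ σ v v' ξ ^ 2 *
      (1 + relWeightDiff κ σ v v' ξ) ^ (2 * m + 2)) (gauss d σ) := by
  have h_meas := measurable_relWeightDiff κ σ v v'
  rw [← lintegral_ofReal_ne_top_iff_integrable (by fun_prop) (ae_of_all _ fun ξ => by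
    have := relWeightDiff_nonneg hκ hσ v v' ξ
    simp only [Pi.zero_apply]
    positivity)]
  exact ((lintegral_relWeightDiff_sq_mul_one_add_pow_le m hκ hσ hκm hRm hv hv').trans_lt
    ENNReal.ofReal_lt_top).ne

theorem integral_relWeightDiff_sq_mul_one_add_pow_le (m : ℕ) (hκ : 0 ≤ κ) (hσ : 0 < σ)
    (hκm : κ * (2 * m + 2) ≤ 1 / 4) (hRm : (2 * m + 4) * (R / σ) ≤ 1 / 6) (hv : ‖v‖ ≤ R)
    (hv' : ‖v'‖ ≤ R) :
    ∫ ξ, relWeightDiff κ σ v v' ξ ^ 2 * (1 + relWeightDiff κ σ v v' ξ) ^ (2 * m + 2) ∂gauss d σ ≤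
      100 * κ ^ 2 := by
  rw [← ENNReal.ofReal_le_ofReal_iff (by positivity), ofReal_integral_eq_lintegral_ofReal
    (integrable_relWeightDiff_sq_mul_one_add_pow m hκ hσ hκm hRm hv hv') (ae_of_all _ fun ξ => by
      have := relWeightDiff_nonneg hκ hσ v v' ξ
      simp only [Pi.zero_apply]
      positivity)]
  exact lintegral_relWeightDiff_sq_mul_one_add_pow_le m hκ hσ hκm hRm hv hv'

theorem integrable_weight_mul (hσ : 0 < σ) (w : E d) {u : E d → ℝ} {c : ℝ} (hu : Measurable u)
    (huc : ∀ ξ, |u ξ| ≤ c) : Integrable (fun ξ => weight σ w ξ * u ξ) (gauss d σ) :=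
  (integrable_weight hσ w).mul_bdd (c := c) hu.aestronglyMeasurable (ae_of_all _ huc)

theorem integral_weight_sub_mul_nonneg (hσ : 0 < σ) {u : E d → ℝ} {c : ℝ} (hu : Measurable u)
    (huc : ∀ ξ, |u ξ| ≤ c) (hmono : ∀ ξ, u (v' + ξ) ≤ u (v + ξ)) :
    0 ≤ ∫ ξ, (weight σ v ξ - weight σ v' ξ) * u ξ ∂gauss d σ := by
  have h_int : ∀ w : E d, Integrable (fun ξ => u (w + ξ)) (gauss d σ) := fun w =>
    Integrable.of_bound (hu.comp (measurable_const_add w)).aestronglyMeasurable c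
      (ae_of_all _ fun ξ => huc _)
  have h_shift : ∀ w : E d, ∫ ξ, weight σ w ξ * u ξ ∂gauss d σ = ∫ ξ, u (w + ξ) ∂gauss d σ :=
    fun w => (integral_gauss_shift hσ w u).symm
  simp_rw [sub_mul]
  rw [integral_sub (integrable_weight_mul hσ v hu huc) (integrable_weight_mul hσ v' hu huc),
    h_shift, h_shift, sub_nonneg]
  exact integral_mono (h_int v') (h_int v) hmono

theorem norm_smul_weight_sub_smul_le {lam L : ℝ} (hσ : 0 < σ) (hlam : 0 ≤ lam) (v v' ξ : E d)
    {y : E d} (hy : ‖y‖ ≤ L) :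
    ‖lam • ((weight σ v ξ - weight σ v' ξ) • y)‖ ≤
      relWeightDiff (lam * L / σ) σ v v' ξ * ‖v - v'‖ := by
  rcases eq_or_ne v v' with rfl | hne
  · simp
  have h_pos : 0 < ‖v - v'‖ := norm_pos_iff.2 (sub_ne_zero.2 hne)
  rw [relWeightDiff, div_mul_cancel₀ _ h_pos.ne', div_mul_cancel₀ _ hσ.ne',
    norm_smul_of_nonneg hlam, norm_smul, Real.norm_eq_abs, mul_assoc, mul_comm L]
  gcongr

theorem lintegral_common_step_le {lam L : ℝ} (hσ : 0 < σ) (hlam : 0 ≤ lam)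
    (m : ℕ) (hκm : lam * L / σ * (2 * m + 2) ≤ 1 / 4)
    (hRm : (2 * m + 4) * (R / σ) ≤ 1 / 6) (hv : ‖v‖ ≤ R) (hv' : ‖v'‖ ≤ R)
    {h : E d → E d} (hh : Measurable h) (hhL : ∀ ξ, ‖h ξ‖ ≤ L)
    (hmono : ∀ ξ, 0 ≤ inner ℝ (v - v') (h (v + ξ) - h (v' + ξ))) :
    ∫⁻ ξ, ‖(v - v') - lam • ((weight σ v ξ - weight σ v' ξ) • h ξ)‖ₑ ^ (2 * m) ∂gauss d σ ≤
      ENNReal.ofReal (1 + 500 * m ^ 2 * (lam * L / σ) ^ 2) * ‖v - v'‖ₑ ^ (2 * m) := by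
  have hL : 0 ≤ L := (norm_nonneg (h 0)).trans (hhL 0)
  have hκ : 0 ≤ lam * L / σ := by positivity
  set u : E d → ℝ := fun ξ => inner ℝ (v - v') (h ξ)
  have hu : Measurable u := by fun_prop
  have hu_bdd : ∀ ξ, |u ξ| ≤ ‖v - v'‖ * L := fun ξ =>
    (abs_real_inner_le_norm _ _).trans (by gcongr; exact hhL ξ)
  have hu_mono : ∀ ξ, u (v' + ξ) ≤ u (v + ξ) := fun ξ => by
    simpa only [inner_sub_right, sub_nonneg] using hmono ξ
  have h_inner : ∀ ξ, inner ℝ (v - v') (lam • ((weight σ v ξ - weight σ v' ξ) • h ξ)) =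
      lam * ((weight σ v ξ - weight σ v' ξ) * u ξ) := fun ξ => by
    rw [real_inner_smul_right, real_inner_smul_right]
  refine (lintegral_enorm_sub_pow_le m
    (fun ξ => norm_smul_weight_sub_smul_le hσ hlam v v' ξ (hhL ξ)) ?_ ?_
    (integrable_relWeightDiff_sq_mul_one_add_pow m hκ hσ hκm hRm hv hv')).trans ?_
  · simp_rw [h_inner, sub_mul]
    exact ((integrable_weight_mul hσ v hu hu_bdd).sub
      (integrable_weight_mul hσ v' hu hu_bdd)).const_mul lam
  · simp_rw [h_inner]
    rw [integral_const_mul]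
    exact mul_nonneg hlam (integral_weight_sub_mul_nonneg hσ hu hu_bdd hu_mono)
  · gcongr ENNReal.ofReal (1 + ?_) * _
    calc _ ≤ 5 * (m : ℝ) ^ 2 * (100 * (lam * L / σ) ^ 2) := by
          gcongr
          exact integral_relWeightDiff_sq_mul_one_add_pow_le m hκ hσ hκm hRm hv hv'
      _ = 500 * m ^ 2 * (lam * L / σ) ^ 2 := by ring

end WeightDifference

section Step

variable {d : ℕ}

theorem norm_ballProj_sub_le (c : E d) {r : ℝ} (hr : 0 ≤ r) (x y : E d) :
    ‖ballProj c r x - ballProj c r y‖ ≤ ‖x - y‖ := by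
  set p := ballProj c r x with hp
  set q := ballProj c r y with hq
  have hx := ballProj_unique c hr x q (ballProj_mem c hr y)
  have hy := ballProj_unique c hr y p (ballProj_mem c hr x)
  rw [← hp, ← sub_sub_sub_cancel_right x q p, norm_sub_sq_real (x - p)] at hx
  rw [← hq, ← sub_sub_sub_cancel_right y p q, norm_sub_sq_real (y - q)] at hy
  have hsplit : inner ℝ (x - y) (p - q) =
      ‖p - q‖ ^ 2 - inner ℝ (x - p) (q - p) - inner ℝ (y - q) (p - q) := by
    rw [← neg_sub p q, inner_neg_right, ← real_inner_self_eq_norm_sq, sub_neg_eq_add,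
      ← inner_add_left, ← inner_sub_left]
    congr 1
    abel
  have hsq : ‖p - q‖ ^ 2 ≤ ‖x - y‖ * ‖p - q‖ := by
    have := real_inner_le_norm (x - y) (p - q)
    rw [norm_sub_rev q p] at hx
    linarith
  rcases (norm_nonneg (p - q)).eq_or_lt' with h0 | h0
  · exact h0.trans_le (norm_nonneg _)
  · nlinarith

theorem measurable_ballProj (c : E d) {r : ℝ} (hr : 0 ≤ r) : Measurable (ballProj c r) :=
  (LipschitzWith.of_dist_le_mul (K := 1) fun x y => by
    simpa [dist_eq_norm] using norm_ballProj_sub_le c hr x y).continuous.measurable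

theorem IsSubgradient.norm_le {f : E d → ℝ} {L : ℝ} (hf : ∀ x y, |f x - f y| ≤ L * ‖x - y‖)
    {x v : E d} (hv : IsSubgradient f x v) (hL : 0 ≤ L) : ‖v‖ ≤ L := by
  have hsub := hv (x + v)
  have hlip := (le_abs_self _).trans (hf (x + v) x)
  rw [add_sub_cancel_left] at hsub hlip
  rw [real_inner_self_eq_norm_sq] at hsub
  rcases (norm_nonneg v).eq_or_lt' with h0 | h0
  · rwa [h0]
  · nlinarith

theorem IsSubgradient.inner_sub_nonneg {f : E d → ℝ} {x y v w : E d} (hv : IsSubgradient f x v)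
    (hw : IsSubgradient f y w) : 0 ≤ inner ℝ (x - y) (v - w) := by
  have hsplit : inner ℝ (x - y) (v - w) = -inner ℝ v (y - x) - inner ℝ w (x - y) := by
    rw [inner_sub_right, real_inner_comm, ← neg_sub x y, inner_neg_right, real_inner_comm w]
    ring
  linarith [hv y, hw x]

/-- A measurable monotone vector field of norm at most `L`, such as a measurable subgradient
selection of a convex `L`-Lipschitz function. -/
structure IsBoundedMonotone (L : ℝ) (G : E d → E d) : Prop where
  measurable : Measurable G
  norm_le : ∀ x, ‖G x‖ ≤ L
  inner_nonneg : ∀ x y, 0 ≤ inner ℝ (x - y) (G x - G y)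

theorem IsBoundedMonotone.of_isSubgradient {f : E d → ℝ} {G : E d → E d} {L : ℝ} (hL : 0 ≤ L)
    (hf : ∀ x y, |f x - f y| ≤ L * ‖x - y‖) (hG : Measurable G)
    (hsub : ∀ x, IsSubgradient f x (G x)) : IsBoundedMonotone L G where
  measurable := hG
  norm_le x := (hsub x).norm_le hf hL
  inner_nonneg x y := (hsub x).inner_sub_nonneg (hsub y)

/-- One step of projected stochastic gradient descent with step size `lam`, oracle `G` and Gaussian
sample `ξ`, started at `y`. -/
noncomputable def projStep (P : Params d) (lam : ℝ) (G : E d → E d) (y ξ : E d) : E d :=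
  ballProj P.xbar P.r (y - lam • estimator P.xbar P.ρ G ξ y)

variable {P : Params d} {lam : ℝ} {G : E d → E d}

theorem norm_projStep_sub_xbar_le (hr : 0 ≤ P.r) (y ξ : E d) :
    ‖projStep P lam G y ξ - P.xbar‖ ≤ P.r :=
  mem_closedBall_iff_norm.1 (ballProj_mem _ hr _)

@[fun_prop]
theorem measurable_projStep (hr : 0 ≤ P.r) (hG : Measurable G) {Ω : Type*} [MeasurableSpace Ω]
    {y ξ : Ω → E d} (hy : Measurable y) (hξ : Measurable ξ) :
    Measurable fun ω => projStep P lam G (y ω) (ξ ω) := by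
  refine (measurable_ballProj _ hr).comp (hy.sub (Measurable.const_smul ?_ lam))
  change Measurable fun ω => weight P.ρ (y ω - P.xbar) (ξ ω) • G (P.xbar + ξ ω)
  fun_prop

theorem norm_projStep_sub_le (hr : 0 ≤ P.r) (hρ : 0 < P.ρ) (hlam : 0 ≤ lam) {G G' : E d → E d}
    (hG : ∀ x, ‖G x‖ ≤ P.L) (hG' : ∀ x, ‖G' x‖ ≤ P.L) (y y' ξ : E d) :
    ‖projStep P lam G y ξ - projStep P lam G' y' ξ‖ ≤
      ‖y - y'‖ + lam * P.L * (weight P.ρ (y - P.xbar) ξ + weight P.ρ (y' - P.xbar) ξ) := by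
  have hest {H : E d → E d} (hH : ∀ x, ‖H x‖ ≤ P.L) (x : E d) :
      ‖lam • estimator P.xbar P.ρ H ξ x‖ ≤ lam * P.L * weight P.ρ (x - P.xbar) ξ := by
    have hw := weight_pos hρ (x - P.xbar) ξ
    change ‖lam • (weight P.ρ (x - P.xbar) ξ • H (P.xbar + ξ))‖ ≤ _
    rw [norm_smul_of_nonneg hlam, norm_smul_of_nonneg hw.le, mul_assoc, mul_comm P.L]
    gcongr
    exact hH _
  refine (norm_ballProj_sub_le _ hr _ _).trans ?_
  rw [sub_sub_sub_comm, mul_add]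
  refine (norm_sub_le _ _).trans ?_
  gcongr
  exact (norm_sub_le _ _).trans (add_le_add (hest hG y) (hest hG' y'))

theorem lintegral_projStep_sub_pow_le (hr : 0 ≤ P.r) (hρ : 0 < P.ρ) (hlam : 0 ≤ lam)
    (hG : IsBoundedMonotone P.L G) {R : ℝ} {m : ℕ}
    (hκm : lam * P.L / P.ρ * (2 * m + 2) ≤ 1 / 4) (hRm : (2 * m + 4) * (R / P.ρ) ≤ 1 / 6)
    {y y' : E d} (hy : ‖y - P.xbar‖ ≤ R) (hy' : ‖y' - P.xbar‖ ≤ R) :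
    ∫⁻ ξ, ‖projStep P lam G y ξ - projStep P lam G y' ξ‖ₑ ^ (2 * m) ∂gauss d P.ρ ≤
      ENNReal.ofReal (1 + 500 * m ^ 2 * (lam * P.L / P.ρ) ^ 2) * ‖y - y'‖ₑ ^ (2 * m) := by
  have hmono : ∀ ξ, 0 ≤ inner ℝ ((y - P.xbar) - (y' - P.xbar))
      (G (P.xbar + (y - P.xbar + ξ)) - G (P.xbar + (y' - P.xbar + ξ))) := fun ξ => by
    convert! hG.inner_nonneg (P.xbar + (y - P.xbar + ξ)) (P.xbar + (y' - P.xbar + ξ)) using 2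
    abel
  have hcontract := lintegral_common_step_le hρ hlam m hκm hRm hy hy'
    (h := fun ξ => G (P.xbar + ξ)) (hG.measurable.comp (measurable_const_add _))
    (fun ξ => hG.norm_le _) hmono
  simp only [sub_sub_sub_cancel_right] at hcontract
  refine (lintegral_mono fun ξ => ?_).trans hcontract
  gcongr
  refine (enorm_le_iff_norm_le.2 (norm_ballProj_sub_le _ hr _ _)).trans_eq ?_
  congr 1
  change y - lam • (weight P.ρ (y - P.xbar) ξ • G (P.xbar + ξ)) -
    (y' - lam • (weight P.ρ (y' - P.xbar) ξ • G (P.xbar + ξ))) = _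
  rw [sub_smul, smul_sub]
  abel

theorem exp_half_le_two : Real.exp (1 / 2) ≤ 2 := by
  refine le_of_pow_le_pow_left₀ two_ne_zero (by norm_num) ?_
  rw [← Real.exp_nat_mul]
  norm_num
  linarith [Real.exp_one_lt_d9]

theorem lintegral_weight_pow_le {σ : ℝ} (hσ : 0 < σ) {v : E d} {p : ℕ} (hpv : p * (‖v‖ / σ) ≤ 1) :
    ∫⁻ ξ, ‖weight σ v ξ‖ₑ ^ p ∂gauss d σ ≤ 2 := by
  simp_rw [Real.enorm_of_nonneg (weight_pos hσ v _).le, ← ENNReal.rpow_natCast]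
  rw [lintegral_weight_rpow hσ v (by positivity)]
  have hexp : (p : ℝ) * (p - 1) * ‖v‖ ^ 2 / (2 * σ ^ 2) ≤ 1 / 2 := by
    calc (p : ℝ) * (p - 1) * ‖v‖ ^ 2 / (2 * σ ^ 2) ≤ p * p * ‖v‖ ^ 2 / (2 * σ ^ 2) := by
          gcongr
          linarith
      _ = (p * (‖v‖ / σ)) ^ 2 / 2 := by ring
      _ ≤ 1 ^ 2 / 2 := by gcongr
      _ = 1 / 2 := by norm_num
  simpa using ENNReal.ofReal_le_ofReal ((Real.exp_le_exp.2 hexp).trans exp_half_le_two)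

end Step

section Resampling

theorem map_update_infinitePi {ι : Type*} [DecidableEq ι] {X : ι → Type*}
    [∀ i, MeasurableSpace (X i)] (μ : ∀ i, Measure (X i)) [∀ i, IsProbabilityMeasure (μ i)]
    (i : ι) :
    ((Measure.infinitePi μ).prod (μ i)).map
      (fun p : (∀ i, X i) × X i => Function.update p.1 i p.2) = Measure.infinitePi μ := by
  refine Measure.eq_infinitePi _ fun s t ht => ?_
  rw [Measure.map_apply measurable_update' (MeasurableSet.pi s.countable_toSet fun j _ => ht j)]
  have hpre : (fun p : (∀ i, X i) × X i => Function.update p.1 i p.2) ⁻¹' ((s : Set ι).pi t) =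
      ((s.erase i : Finset ι) : Set ι).pi t ×ˢ {b | i ∈ s → b ∈ t i} := by
    ext p
    rw [Set.mem_preimage, Set.update_mem_pi_iff, Finset.coe_erase]
    rfl
  rw [hpre, Measure.prod_prod, Measure.infinitePi_pi _ fun j _ => ht j]
  by_cases hi : i ∈ s
  · simpa only [hi, forall_const, Set.ofPred_mem_eq] using
      Finset.prod_erase_mul s (fun j => μ j (t j)) hi
  · simp [hi]

variable {ι X β : Type*} [DecidableEq ι] [MeasurableSpace X] [MeasurableSpace β]

theorem lintegral_infinitePi_resample (μ : Measure X) [IsProbabilityMeasure μ] (i : ι)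
    {Y : (ι → X) → β} (hY : Measurable Y) (hYi : ∀ ξ a, Y (Function.update ξ i a) = Y ξ)
    {F : β → X → ℝ≥0∞} (hF : Measurable (Function.uncurry F)) :
    ∫⁻ ξ, F (Y ξ) (ξ i) ∂Measure.infinitePi (fun _ : ι => μ) =
      ∫⁻ ξ, ∫⁻ a, F (Y ξ) a ∂μ ∂Measure.infinitePi (fun _ : ι => μ) := by
  have hmeas : Measurable fun ξ : ι → X => F (Y ξ) (ξ i) :=
    hF.comp (hY.prodMk (measurable_pi_apply i))
  conv_lhs => rw [← map_update_infinitePi (fun _ : ι => μ) i]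
  rw [lintegral_map hmeas measurable_update']
  simp only [hYi, Function.update_self]
  exact lintegral_prod (fun p => F (Y p.1) p.2) (by fun_prop)

theorem eLpNorm_natCast_pow {Ω V : Type*} [MeasurableSpace Ω] [NormedAddCommGroup V] {p : ℕ}
    (hp : p ≠ 0) (f : Ω → V) (μ : Measure Ω) : eLpNorm f p μ ^ p = ∫⁻ ω, ‖f ω‖ₑ ^ p ∂μ := by
  have h := eLpNorm_nnreal_pow_eq_lintegral (f := f) (μ := μ) (Nat.cast_ne_zero.2 hp)
  simpa using h

theorem eLpNorm_infinitePi_resample_le {V W : Type*} [NormedAddCommGroup V] [MeasurableSpace V]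
    [OpensMeasurableSpace V] [NormedAddCommGroup W] (μ : Measure X) [IsProbabilityMeasure μ]
    (i : ι) {Y : (ι → X) → β} (hY : Measurable Y) (hYi : ∀ ξ a, Y (Function.update ξ i a) = Y ξ)
    {F : β → X → V} (hF : Measurable (Function.uncurry F)) {H : (ι → X) → W} {C : ℝ≥0∞}
    (hC : C ≠ ∞) {p : ℕ} (hp : p ≠ 0)
    (hFH : ∀ ξ, ∫⁻ a, ‖F (Y ξ) a‖ₑ ^ p ∂μ ≤ (C * ‖H ξ‖ₑ) ^ p) :
    eLpNorm (fun ξ => F (Y ξ) (ξ i)) p (Measure.infinitePi fun _ => μ) ≤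
      C * eLpNorm H p (Measure.infinitePi fun _ => μ) := by
  rw [← ENNReal.pow_le_pow_left_iff hp, mul_pow, eLpNorm_natCast_pow hp, eLpNorm_natCast_pow hp,
    ← lintegral_const_mul' _ _ (by finiteness),
    lintegral_infinitePi_resample μ i hY hYi (F := fun y a => ‖F y a‖ₑ ^ p)
      (hF.enorm.pow_const p)]
  exact lintegral_mono fun ξ => (hFH ξ).trans_eq (mul_pow _ _ _)

end Resampling

section InnerLoop

/-- The number of `l` with `1 ≤ l ≤ j` at which the sampled index `z l` is `a`. -/
def hits {κ : Type*} [DecidableEq κ] (z : ℕ → κ) (a : κ) (j : ℕ) : ℕ :=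
  ((Finset.Icc 1 j).filter fun l => z l = a).card

theorem hits_succ {κ : Type*} [DecidableEq κ] (z : ℕ → κ) (a : κ) (j : ℕ) :
    hits z a (j + 1) = hits z a j + if z (j + 1) = a then 1 else 0 := by
  rw [hits, hits, ← Finset.insert_Icc_right_eq_Icc_add_one (by lia), Finset.filter_insert]
  split_ifs
  · exact Finset.card_insert_of_notMem (by simp)
  · rfl

theorem hits_mono {κ : Type*} [DecidableEq κ] (z : ℕ → κ) (a : κ) : Monotone (hits z a) :=
  fun _ _ h => Finset.card_le_card (Finset.filter_subset_filter _ (Finset.Icc_subset_Icc_right h))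

variable {d n : ℕ} {S : Type*} {P : Params d} {g : S → E d → E d} {D D' : Fin n → S}
  {z : ℕ → ℕ → Fin n} {i : ℕ} {a : Fin n}

theorem measurable_innerIter (hr : 0 ≤ P.r) (hg : ∀ s, Measurable (g s)) (j : ℕ) :
    Measurable fun p : E d × (ℕ → E d) => innerIter P g D z i p.1 p.2 j := by
  induction j with
  | zero => exact measurable_fst
  | succ j ih => exact measurable_projStep hr (hg _) ih (by fun_prop)

theorem measurable_innerAvg (hr : 0 ≤ P.r) (hg : ∀ s, Measurable (g s)) :
    Measurable fun p : E d × (ℕ → E d) => innerAvg P g D z i p.1 p.2 :=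
  (Finset.measurable_fun_sum (Finset.Icc 1 (P.Ti i)) fun j _ =>
    measurable_innerIter hr hg j).fun_const_smul _

theorem innerIter_update (y0 : E d) (ξ : ℕ → E d) {j l : ℕ} (hjl : j < l) (x : E d) :
    innerIter P g D z i y0 (Function.update ξ l x) j = innerIter P g D z i y0 ξ j := by
  induction j with
  | zero => rfl
  | succ j ih => simp only [innerIter, ih (by lia), Function.update_of_ne hjl.ne]

theorem norm_innerIter_sub_xbar_le (hr : 0 ≤ P.r) {R : ℝ} (hrR : P.r ≤ R) {y0 : E d}
    (hy0 : ‖y0 - P.xbar‖ ≤ R) (ξ : ℕ → E d) (j : ℕ) :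
    ‖innerIter P g D z i y0 ξ j - P.xbar‖ ≤ R := by
  cases j with
  | zero => exact hy0
  | succ j => exact (norm_projStep_sub_xbar_le hr _ _).trans hrR

theorem norm_innerAvg_sub_xbar_le (hr : 0 ≤ P.r) (hTi : 1 ≤ P.Ti i) (y0 : E d) (ξ : ℕ → E d) :
    ‖innerAvg P g D z i y0 ξ - P.xbar‖ ≤ P.r := by
  have hTi0 : (0 : ℝ) < P.Ti i := by exact_mod_cast hTi
  rw [← mem_closedBall_iff_norm, innerAvg, Finset.smul_sum]
  refine (convex_closedBall P.xbar P.r).sum_mem (fun _ _ => by positivity)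
    (by simp [hTi0.ne']) fun j hj => mem_closedBall_iff_norm.2 ?_
  obtain ⟨l, rfl⟩ := Nat.exists_eq_add_of_le' (Finset.mem_Icc.1 hj).1
  exact norm_projStep_sub_xbar_le hr _ _

theorem innerIter_congr {j : ℕ} (hD : ∀ l, 1 ≤ l → l ≤ j → D (z i l) = D' (z i l)) (y0 : E d)
    (ξ : ℕ → E d) : innerIter P g D z i y0 ξ j = innerIter P g D' z i y0 ξ j := by
  induction j with
  | zero => rfl
  | succ j ih =>
    simp only [innerIter, ih fun l h1 h2 => hD l h1 (by lia), hD (j + 1) (by lia) le_rfl]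

theorem innerAvg_congr_of_hits_eq_zero (hD : ∀ b, b ≠ a → D b = D' b)
    (hz : hits (z i) a (P.Ti i) = 0) (y0 : E d) (ξ : ℕ → E d) :
    innerAvg P g D z i y0 ξ = innerAvg P g D' z i y0 ξ := by
  have hne : ∀ l ∈ Finset.Icc 1 (P.Ti i), z i l ≠ a :=
    fun l hl => Finset.filter_eq_empty_iff.1 (Finset.card_eq_zero.1 hz) hl
  unfold innerAvg
  congr 1
  refine Finset.sum_congr rfl fun j hj => innerIter_congr (fun l h1 h2 => hD _ ?_) y0 ξ
  exact hne l (Finset.mem_Icc.2 ⟨h1, h2.trans (Finset.mem_Icc.1 hj).2⟩)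

/-- The law of the Gaussian samples `ξ_{i,1}, ξ_{i,2}, …` of one inner loop. -/
noncomputable abbrev gaussSeq (d : ℕ) (ρ : ℝ) : Measure (ℕ → E d) :=
  Measure.infinitePi fun _ => gauss d ρ

/-- The difference of the `j`-th iterates of the `i`-th inner loops on `D` and on `D'`, started at
the same point and driven by the same Gaussian samples. -/
noncomputable def iterGap (P : Params d) (g : S → E d → E d) (D D' : Fin n → S)
    (z : ℕ → ℕ → Fin n) (i : ℕ) (y0 : E d) (j : ℕ) (ξ : ℕ → E d) : E d :=
  innerIter P g D z i y0 ξ j - innerIter P g D' z i y0 ξ j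

/-- A bound for the growth of the `2m`-th moment of the distance between two iterates of the `i`-th
inner loop in a step in which both use the same oracle. -/
noncomputable def stepGrowth (P : Params d) (i m : ℕ) : ℝ :=
  1 + 500 * m ^ 2 * (P.ηi i * P.L / P.ρ) ^ 2

theorem one_le_stepGrowth (P : Params d) (i m : ℕ) : 1 ≤ stepGrowth P i m :=
  le_add_of_nonneg_right (by positivity)

variable {y0 : E d} {R : ℝ} {m : ℕ}

theorem measurable_innerIter_right (hr : 0 ≤ P.r) (hg : ∀ s, Measurable (g s)) (j : ℕ) :
    Measurable fun ξ => innerIter P g D z i y0 ξ j :=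
  (measurable_innerIter hr hg j).comp measurable_prodMk_left

theorem measurable_iterGap (hr : 0 ≤ P.r) (hg : ∀ s, Measurable (g s)) (j : ℕ) :
    Measurable (iterGap P g D D' z i y0 j) :=
  (measurable_innerIter_right hr hg j).sub (measurable_innerIter_right hr hg j)

theorem eLpNorm_iterGap_succ_le_mul (hr : 0 ≤ P.r) (hρ : 0 < P.ρ)
    (hg : ∀ s, IsBoundedMonotone P.L (g s)) (hη : 0 ≤ P.ηi i) (hm : m ≠ 0) (hrR : P.r ≤ R)
    (hκm : P.ηi i * P.L / P.ρ * (2 * m + 2) ≤ 1 / 4) (hRm : (2 * m + 4) * (R / P.ρ) ≤ 1 / 6)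
    (hy0 : ‖y0 - P.xbar‖ ≤ R) {j : ℕ} (hD : D (z i (j + 1)) = D' (z i (j + 1))) :
    eLpNorm (iterGap P g D D' z i y0 (j + 1)) (2 * m : ℕ) (gaussSeq d P.ρ) ≤
      ENNReal.ofReal (stepGrowth P i m) *
        eLpNorm (iterGap P g D D' z i y0 j) (2 * m : ℕ) (gaussSeq d P.ρ) := by
  have hgm : ∀ s, Measurable (g s) := fun s => (hg s).measurable
  have hgap : iterGap P g D D' z i y0 (j + 1) = fun ξ =>
      projStep P (P.ηi i) (g (D (z i (j + 1)))) (innerIter P g D z i y0 ξ j) (ξ (j + 1)) -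
        projStep P (P.ηi i) (g (D (z i (j + 1)))) (innerIter P g D' z i y0 ξ j) (ξ (j + 1)) := by
    funext ξ
    simp only [iterGap, innerIter, projStep, hD]
  rw [hgap]
  refine eLpNorm_infinitePi_resample_le (gauss d P.ρ) (j + 1)
    (Y := fun ξ => (innerIter P g D z i y0 ξ j, innerIter P g D' z i y0 ξ j))
    (F := fun y x => projStep P (P.ηi i) (g (D (z i (j + 1)))) y.1 x -
      projStep P (P.ηi i) (g (D (z i (j + 1)))) y.2 x)
    ((measurable_innerIter_right hr hgm j).prodMk (measurable_innerIter_right hr hgm j))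
    (fun ξ x => by simp only [innerIter_update _ _ j.lt_succ_self]) ?_ ENNReal.ofReal_ne_top
    (by lia) fun ξ => ?_
  · exact (measurable_projStep hr (hgm _) (by fun_prop) (by fun_prop)).sub
      (measurable_projStep hr (hgm _) (by fun_prop) (by fun_prop))
  · refine (lintegral_projStep_sub_pow_le hr hρ hη (hg _) hκm hRm
      (norm_innerIter_sub_xbar_le hr hrR hy0 ξ j)
      (norm_innerIter_sub_xbar_le hr hrR hy0 ξ j)).trans ?_
    rw [mul_pow]
    refine mul_le_mul_left ?_ _
    exact le_self_pow₀ (ENNReal.one_le_ofReal.2 (one_le_stepGrowth P i m)) (by lia)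

theorem eLpNorm_weight_innerIter_le (hr : 0 ≤ P.r) (hρ : 0 < P.ρ) (hg : ∀ s, Measurable (g s))
    (hm : m ≠ 0) (hrR : P.r ≤ R) (hRm : 2 * m * (R / P.ρ) ≤ 1) (hy0 : ‖y0 - P.xbar‖ ≤ R) (j : ℕ) :
    eLpNorm (fun ξ => weight P.ρ (innerIter P g D z i y0 ξ j - P.xbar) (ξ (j + 1))) (2 * m : ℕ)
      (gaussSeq d P.ρ) ≤ 2 := by
  have hone : eLpNorm (fun _ : ℕ → E d => (1 : ℝ)) (2 * m : ℕ) (gaussSeq d P.ρ) = 1 := by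
    rw [eLpNorm_const _ (by exact_mod_cast (by lia : 2 * m ≠ 0)) (NeZero.ne _)]
    simp
  refine (eLpNorm_infinitePi_resample_le (gauss d P.ρ) (j + 1) (H := fun _ => (1 : ℝ))
    (F := fun y x => weight P.ρ (y - P.xbar) x) (measurable_innerIter_right hr hg j)
    (fun ξ x => innerIter_update _ _ j.lt_succ_self x)
    (measurable_weight (measurable_fst.sub_const _) measurable_snd)
    ENNReal.ofNat_ne_top (by lia) fun ξ => ?_).trans_eq (by rw [hone, mul_one])
  refine (lintegral_weight_pow_le hρ (le_trans ?_ hRm)).trans ?_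
  · push_cast
    gcongr
    exact norm_innerIter_sub_xbar_le hr hrR hy0 ξ j
  · rw [enorm_one, mul_one]
    exact le_self_pow₀ one_le_two (by lia)

theorem eLpNorm_iterGap_succ_le_add (hr : 0 ≤ P.r) (hρ : 0 < P.ρ) (hL : 0 ≤ P.L)
    (hg : ∀ s, Measurable (g s)) (hgL : ∀ s x, ‖g s x‖ ≤ P.L) (hη : 0 ≤ P.ηi i) (hm : m ≠ 0)
    (hrR : P.r ≤ R) (hRm : 2 * m * (R / P.ρ) ≤ 1) (hy0 : ‖y0 - P.xbar‖ ≤ R) (j : ℕ) :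
    eLpNorm (iterGap P g D D' z i y0 (j + 1)) (2 * m : ℕ) (gaussSeq d P.ρ) ≤
      eLpNorm (iterGap P g D D' z i y0 j) (2 * m : ℕ) (gaussSeq d P.ρ) +
        ENNReal.ofReal (4 * (P.ηi i * P.L)) := by
  have hp : (1 : ℝ≥0∞) ≤ (2 * m : ℕ) := by exact_mod_cast (by lia : 1 ≤ 2 * m)
  set W : (Fin n → S) → (ℕ → E d) → ℝ := fun D ξ =>
    weight P.ρ (innerIter P g D z i y0 ξ j - P.xbar) (ξ (j + 1))
  have hWm (D : Fin n → S) : Measurable (W D) :=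
    measurable_weight ((measurable_innerIter_right hr hg j).sub_const _) (measurable_pi_apply _)
  have hgapm := measurable_iterGap (D := D) (D' := D') (z := z) (i := i) (y0 := y0) hr hg j
  calc eLpNorm (iterGap P g D D' z i y0 (j + 1)) (2 * m : ℕ) (gaussSeq d P.ρ)
      ≤ eLpNorm ((fun ξ => ‖iterGap P g D D' z i y0 j ξ‖) + (P.ηi i * P.L) • (W D + W D'))
          (2 * m : ℕ) (gaussSeq d P.ρ) :=
        eLpNorm_mono_real fun ξ => norm_projStep_sub_le hr hρ hη (hgL _) (hgL _) _ _ _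
    _ ≤ eLpNorm (fun ξ => ‖iterGap P g D D' z i y0 j ξ‖) (2 * m : ℕ) (gaussSeq d P.ρ) +
          eLpNorm ((P.ηi i * P.L) • (W D + W D')) (2 * m : ℕ) (gaussSeq d P.ρ) :=
        eLpNorm_add_le hgapm.norm.aestronglyMeasurable
          (((hWm D).add (hWm D')).const_smul _).aestronglyMeasurable hp
    _ ≤ _ := by
        rw [eLpNorm_norm, eLpNorm_const_smul, Real.enorm_of_nonneg (by positivity), mul_comm 4,
          ENNReal.ofReal_mul (by positivity : 0 ≤ P.ηi i * P.L)]
        gcongr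
        refine (eLpNorm_add_le (hWm D).aestronglyMeasurable (hWm D').aestronglyMeasurable
          hp).trans ((add_le_add (eLpNorm_weight_innerIter_le hr hρ hg hm hrR hRm hy0 j)
          (eLpNorm_weight_innerIter_le hr hρ hg hm hrR hRm hy0 j)).trans_eq ?_)
        norm_num

theorem eLpNorm_iterGap_le (hr : 0 ≤ P.r) (hρ : 0 < P.ρ) (hL : 0 ≤ P.L)
    (hg : ∀ s, IsBoundedMonotone P.L (g s)) (hD : ∀ b, b ≠ a → D b = D' b) (hη : 0 ≤ P.ηi i)
    (hm : m ≠ 0) (hrR : P.r ≤ R) (hκm : P.ηi i * P.L / P.ρ * (2 * m + 2) ≤ 1 / 4)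
    (hRm : (2 * m + 4) * (R / P.ρ) ≤ 1 / 6) (hy0 : ‖y0 - P.xbar‖ ≤ R) (j : ℕ) :
    eLpNorm (iterGap P g D D' z i y0 j) (2 * m : ℕ) (gaussSeq d P.ρ) ≤
      ENNReal.ofReal (stepGrowth P i m ^ j * (4 * (P.ηi i * P.L) * hits (z i) a j)) := by
  have hG := one_le_stepGrowth P i m
  induction j with
  | zero =>
    have : iterGap P g D D' z i y0 0 = 0 := funext fun _ => sub_self _
    simp [this]
  | succ j ih =>
    rw [hits_succ]
    split_ifs with hz
    · have hRm' : 2 * m * (R / P.ρ) ≤ 1 := by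
        have : 0 ≤ R / P.ρ := div_nonneg (hr.trans hrR) hρ.le
        linarith
      refine (eLpNorm_iterGap_succ_le_add hr hρ hL (fun s => (hg s).measurable)
        (fun s => (hg s).norm_le) hη hm hrR hRm' hy0 j).trans ((add_le_add_left ih _).trans ?_)
      rw [← ENNReal.ofReal_add (by positivity) (by positivity)]
      refine ENNReal.ofReal_le_ofReal ?_
      push_cast
      rw [mul_add_one (4 * _), mul_add (_ ^ (j + 1))]
      exact add_le_add
        (mul_le_mul_of_nonneg_right (pow_le_pow_right₀ hG j.le_succ) (by positivity))
        (le_mul_of_one_le_left (by positivity) (one_le_pow₀ hG))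
    · refine (eLpNorm_iterGap_succ_le_mul hr hρ hg hη hm hrR hκm hRm hy0 (hD _ hz)).trans
        ((mul_le_mul_right ih _).trans_eq ?_)
      rw [← ENNReal.ofReal_mul (by positivity), pow_succ', add_zero, mul_assoc (stepGrowth P i m)]

theorem stepGrowth_pow_le {N : ℕ} (hκT : N * (500 * m ^ 2 * (P.ηi i * P.L / P.ρ) ^ 2) ≤ 1 / 10)
    {j : ℕ} (hj : j ≤ N) : stepGrowth P i m ^ j ≤ 5 / 4 := by
  set ε : ℝ := 500 * m ^ 2 * (P.ηi i * P.L / P.ρ) ^ 2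
  have hexp : stepGrowth P i m ^ j ≤ Real.exp (1 / 10) := by
    calc (1 + ε) ^ j ≤ (1 + ε) ^ N := pow_le_pow_right₀ (one_le_stepGrowth P i m) hj
      _ ≤ Real.exp ε ^ N := by
        gcongr
        linarith [Real.add_one_le_exp ε]
      _ = Real.exp (N * ε) := (Real.exp_nat_mul _ _).symm
      _ ≤ Real.exp (1 / 10) := Real.exp_le_exp.2 hκT
  refine hexp.trans (le_of_pow_le_pow_left₀ (n := 10) (by norm_num) (by norm_num) ?_)
  rw [← Real.exp_nat_mul]
  norm_num
  linarith [Real.exp_one_lt_d9]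

theorem eLpNorm_innerAvg_sub_le (hr : 0 ≤ P.r) (hg : ∀ s, Measurable (g s)) (hm : m ≠ 0)
    (hTi : 1 ≤ P.Ti i) {C : ℝ≥0∞}
    (hC : ∀ j ∈ Finset.Icc 1 (P.Ti i),
      eLpNorm (iterGap P g D D' z i y0 j) (2 * m : ℕ) (gaussSeq d P.ρ) ≤ C) :
    eLpNorm (fun ξ => innerAvg P g D z i y0 ξ - innerAvg P g D' z i y0 ξ) (2 * m : ℕ)
      (gaussSeq d P.ρ) ≤ C := by
  have hp : (1 : ℝ≥0∞) ≤ (2 * m : ℕ) := by exact_mod_cast (by lia : 1 ≤ 2 * m)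
  have hTi0 : (0 : ℝ) < P.Ti i := by exact_mod_cast hTi
  have havg : (fun ξ => innerAvg P g D z i y0 ξ - innerAvg P g D' z i y0 ξ) =
      (1 / (P.Ti i : ℝ)) • ∑ j ∈ Finset.Icc 1 (P.Ti i), iterGap P g D D' z i y0 j := by
    funext ξ
    simp only [innerAvg, iterGap, ← smul_sub, ← Finset.sum_sub_distrib, Pi.smul_apply,
      Finset.sum_apply]
  rw [havg, eLpNorm_const_smul, Real.enorm_of_nonneg (by positivity)]
  have hsum : eLpNorm (∑ j ∈ Finset.Icc 1 (P.Ti i), iterGap P g D D' z i y0 j) (2 * m : ℕ)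
      (gaussSeq d P.ρ) ≤ P.Ti i * C := by
    refine (eLpNorm_sum_le (fun j _ => (measurable_iterGap hr hg j).aestronglyMeasurable)
      hp).trans ((Finset.sum_le_card_nsmul _ _ _ hC).trans_eq ?_)
    rw [Nat.card_Icc, Nat.add_sub_cancel, nsmul_eq_mul]
  refine (mul_le_mul_right hsum _).trans_eq ?_
  rw [← mul_assoc, ← ENNReal.ofReal_natCast, ← ENNReal.ofReal_mul (by positivity),
    one_div_mul_cancel hTi0.ne', ENNReal.ofReal_one, one_mul]

theorem measure_ten_mul_lt_norm_le {Ω V : Type*} [MeasurableSpace Ω] [NormedAddCommGroup V]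
    {μ : Measure Ω} {f : Ω → V} (hf : AEStronglyMeasurable f μ) (hm : m ≠ 0) {c : ℝ} (hc : 0 < c)
    (hfc : eLpNorm f (2 * m : ℕ) μ ≤ ENNReal.ofReal c) :
    μ {ω | 10 * c < ‖f ω‖} ≤ ENNReal.ofReal ((1 / 100) ^ m) := by
  have hp : ((2 * m : ℕ) : ℝ≥0∞) ≠ 0 := by exact_mod_cast (by lia : 2 * m ≠ 0)
  have hmarkov := mul_meas_ge_le_pow_eLpNorm' μ hp (ENNReal.natCast_ne_top _) hf
    (ENNReal.ofReal (10 * c))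
  simp only [ENNReal.toReal_natCast, ENNReal.rpow_natCast] at hmarkov
  have hsub : {ω | 10 * c < ‖f ω‖} ⊆ {ω | ENNReal.ofReal (10 * c) ≤ ‖f ω‖ₑ} := fun ω hω => by
    have hω' : 10 * c < ‖f ω‖ := hω
    rw [Set.mem_ofPred_eq, ← ofReal_norm]
    exact ENNReal.ofReal_le_ofReal hω'.le
  have hc0 : ENNReal.ofReal (10 * c) ^ (2 * m) ≠ 0 :=
    pow_ne_zero _ (ENNReal.ofReal_pos.2 (by positivity)).ne'
  refine (measure_mono hsub).trans ?_
  rw [← ENNReal.mul_le_mul_iff_right hc0 (by finiteness)]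
  refine hmarkov.trans ((pow_le_pow_left' hfc _).trans_eq ?_)
  rw [← ENNReal.ofReal_pow hc.le, ← ENNReal.ofReal_pow (by positivity),
    ← ENNReal.ofReal_mul (by positivity), pow_mul, pow_mul, ← mul_pow]
  ring_nf

theorem measure_lt_norm_innerAvg_sub_le (hr : 0 ≤ P.r) (hρ : 0 < P.ρ) (hL : 0 < P.L)
    (hg : ∀ s, IsBoundedMonotone P.L (g s)) (hD : ∀ b, b ≠ a → D b = D' b) (hη : 0 < P.ηi i)
    (hTi : 1 ≤ P.Ti i) (hm : m ≠ 0) (hrR : P.r ≤ R)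
    (hκm : P.ηi i * P.L / P.ρ * (2 * m + 2) ≤ 1 / 4)
    (hκT : P.Ti i * (500 * m ^ 2 * (P.ηi i * P.L / P.ρ) ^ 2) ≤ 1 / 10)
    (hRm : (2 * m + 4) * (R / P.ρ) ≤ 1 / 6) (hy0 : ‖y0 - P.xbar‖ ≤ R) :
    gaussSeq d P.ρ {ξ | 50 * (P.ηi i * P.L) * hits (z i) a (P.Ti i) <
        ‖innerAvg P g D z i y0 ξ - innerAvg P g D' z i y0 ξ‖} ≤
      ENNReal.ofReal ((1 / 100) ^ m) := by
  rcases Nat.eq_zero_or_pos (hits (z i) a (P.Ti i)) with hz | hz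
  · simp [innerAvg_congr_of_hits_eq_zero hD hz, hz]
  set c : ℝ := 5 * (P.ηi i * P.L) * hits (z i) a (P.Ti i)
  have hc : 0 < c := by positivity
  have hgm : ∀ s, Measurable (g s) := fun s => (hg s).measurable
  have hmom : ∀ j ∈ Finset.Icc 1 (P.Ti i),
      eLpNorm (iterGap P g D D' z i y0 j) (2 * m : ℕ) (gaussSeq d P.ρ) ≤ ENNReal.ofReal c := by
    intro j hj
    have hjT := (Finset.mem_Icc.1 hj).2
    refine (eLpNorm_iterGap_le hr hρ hL.le hg hD hη.le hm hrR hκm hRm hy0 j).trans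
      (ENNReal.ofReal_le_ofReal ?_)
    calc stepGrowth P i m ^ j * (4 * (P.ηi i * P.L) * hits (z i) a j)
        ≤ 5 / 4 * (4 * (P.ηi i * P.L) * hits (z i) a (P.Ti i)) := by
          gcongr
          · exact stepGrowth_pow_le hκT hjT
          · exact hits_mono (z i) a hjT
      _ = c := by ring
  have hmeas (D : Fin n → S) : Measurable fun ξ => innerAvg P g D z i y0 ξ :=
    (measurable_innerAvg hr hgm).comp measurable_prodMk_left
  have hthr : 50 * (P.ηi i * P.L) * hits (z i) a (P.Ti i) = 10 * c := by ring
  rw [hthr]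
  exact measure_ten_mul_lt_norm_le ((hmeas D).sub (hmeas D')).aestronglyMeasurable hm hc
    (eLpNorm_innerAvg_sub_le hr hgm hm hTi hmom)

end InnerLoop

section Chain

variable {d : ℕ} {Ξ : Type*} [MeasurableSpace Ξ]

/-- The law of the `i`-th state of the Markov chain with transitions `x ↦ F i x ξ + ζ`, where
`ξ ∼ κ` and `ζ ∼ N(0, (σ i)² I_d)` are drawn afresh. The `i`-th transition leads to state `i`. -/
noncomputable def chainLaw (κ : Measure Ξ) (x0 : E d) (σ : ℕ → ℝ) (F : ℕ → E d → Ξ → E d) :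
    ℕ → Measure (E d)
  | 0 => Measure.dirac x0
  | i + 1 => (((chainLaw κ x0 σ F i).prod κ).prod (gauss d (σ (i + 1)))).map
      fun p => F (i + 1) p.1.1 p.1.2 + p.2

/-- The transition `G`, replaced by `F` where the two are more than `Δ` apart. It stays within `Δ`
of `F` everywhere and agrees with `G` wherever `F` and `G` are close. -/
noncomputable def hybrid (Δ : ℕ → ℝ) (F G : ℕ → E d → Ξ → E d) (i : ℕ) (x : E d) (ξ : Ξ) : E d :=
  open Classical in if Δ i < ‖F i x ξ - G i x ξ‖ then F i x ξ else G i x ξ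

variable {κ : Measure Ξ} [IsProbabilityMeasure κ] {x0 : E d} {σ Δ : ℕ → ℝ}
  {F G : ℕ → E d → Ξ → E d}

theorem measurable_chainStep (hF : ∀ i, Measurable fun p : E d × Ξ => F i p.1 p.2) (i : ℕ) :
    Measurable fun p : (E d × Ξ) × E d => F i p.1.1 p.1.2 + p.2 :=
  ((hF i).comp measurable_fst).add measurable_snd

theorem isProbabilityMeasure_chainLaw (hF : ∀ i, Measurable fun p : E d × Ξ => F i p.1 p.2)
    (i : ℕ) : IsProbabilityMeasure (chainLaw κ x0 σ F i) := by
  induction i with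
  | zero => exact Measure.dirac.isProbabilityMeasure
  | succ i ih => exact Measure.isProbabilityMeasure_map (measurable_chainStep hF _).aemeasurable

theorem renyiBound_chainLaw {α q : ℝ} (hq : α.HolderConjugate q)
    (hF : ∀ i, Measurable fun p : E d × Ξ => F i p.1 p.2)
    (hG : ∀ i, Measurable fun p : E d × Ξ => G i p.1 p.2)
    (hΔ : ∀ i x ξ, ‖F i x ξ - G i x ξ‖ ≤ Δ i) (hσ : ∀ i, 0 < σ i) (k : ℕ) :
    RenyiBound q (∑ i ∈ Finset.Icc 1 k, α * Δ i ^ 2 / (2 * σ i ^ 2)) (chainLaw κ x0 σ F k)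
      (chainLaw κ x0 σ G k) := by
  induction k with
  | zero => exact RenyiBound.refl hq (Measure.dirac x0)
  | succ k ih =>
    have := isProbabilityMeasure_chainLaw (κ := κ) (x0 := x0) (σ := σ) hF k
    have := isProbabilityMeasure_chainLaw (κ := κ) (x0 := x0) (σ := σ) hG k
    rw [Finset.sum_Icc_succ_top (by lia)]
    exact (ih.prod hq κ).add_gauss (hσ _) hq (hF _) (hG _) fun _ => hΔ _ _ _

theorem tvBound_chainLaw (hF : ∀ i, Measurable fun p : E d × Ξ => F i p.1 p.2)
    (hG : ∀ i, Measurable fun p : E d × Ξ => G i p.1 p.2) {e : ℕ → ℝ≥0∞} {k : ℕ}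
    (he : ∀ i < k,
      ((chainLaw κ x0 σ G i).prod κ) {p | F (i + 1) p.1 p.2 ≠ G (i + 1) p.1 p.2} ≤ e i) :
    TVBound (∑ i ∈ Finset.range k, e i) (chainLaw κ x0 σ F k) (chainLaw κ x0 σ G k) := by
  induction k with
  | zero => exact TVBound.refl (Measure.dirac x0)
  | succ k ih =>
    have := isProbabilityMeasure_chainLaw (κ := κ) (x0 := x0) (σ := σ) hF k
    have := isProbabilityMeasure_chainLaw (κ := κ) (x0 := x0) (σ := σ) hG k
    set μ := ((chainLaw κ x0 σ G k).prod κ).prod (gauss d (σ (k + 1)))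
    have hcouple : μ {p | F (k + 1) p.1.1 p.1.2 + p.2 ≠ G (k + 1) p.1.1 p.1.2 + p.2} ≤ e k := by
      have hset : {p : (E d × Ξ) × E d | F (k + 1) p.1.1 p.1.2 + p.2 ≠ G (k + 1) p.1.1 p.1.2 + p.2}
          = {p | F (k + 1) p.1 p.2 ≠ G (k + 1) p.1 p.2} ×ˢ Set.univ := by
        ext p
        simp
      rw [hset, Measure.prod_prod, measure_univ, mul_one]
      exact he k k.lt_succ_self
    have hstep := measurable_chainStep hF (k + 1)
    rw [Finset.sum_range_succ]
    exact ((((ih fun i hi => he i (by lia)).prod κ).prod _).map hstep).trans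
      ((tvBound_map_of_coupling hstep (measurable_chainStep hG (k + 1))).mono hcouple)

theorem exists_law_near_chainLaw {α q : ℝ} (hq : α.HolderConjugate q)
    (hF : ∀ i, Measurable fun p : E d × Ξ => F i p.1 p.2)
    (hG : ∀ i, Measurable fun p : E d × Ξ => G i p.1 p.2) (hΔ : ∀ i, 0 ≤ Δ i)
    (hσ : ∀ i, 0 < σ i) {e : ℕ → ℝ≥0∞} {k : ℕ}
    (he : ∀ i < k, ((chainLaw κ x0 σ G i).prod κ)
      {p | Δ (i + 1) < ‖F (i + 1) p.1 p.2 - G (i + 1) p.1 p.2‖} ≤ e i) :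
    ∃ ν : Measure (E d), IsProbabilityMeasure ν ∧
      TVBound (∑ i ∈ Finset.range k, e i) ν (chainLaw κ x0 σ G k) ∧
      RenyiBound q (∑ i ∈ Finset.Icc 1 k, α * Δ i ^ 2 / (2 * σ i ^ 2)) (chainLaw κ x0 σ F k) ν := by
  have hH (i : ℕ) : Measurable fun p : E d × Ξ => hybrid Δ F G i p.1 p.2 :=
    Measurable.ite (measurableSet_lt measurable_const ((hF i).sub (hG i)).norm) (hF i) (hG i)
  have hFH (i : ℕ) (x : E d) (ξ : Ξ) : ‖F i x ξ - hybrid Δ F G i x ξ‖ ≤ Δ i := by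
    unfold hybrid
    split_ifs with h
    · rw [sub_self, norm_zero]
      exact hΔ i
    · exact not_lt.1 h
  refine ⟨chainLaw κ x0 σ (hybrid Δ F G) k, isProbabilityMeasure_chainLaw hH k,
    tvBound_chainLaw hH hG fun i hi => (measure_mono fun p hp => ?_).trans (he i hi),
    renyiBound_chainLaw hq hF hH hFH hσ k⟩
  by_contra hle
  exact hp (if_neg hle)

theorem chainLaw_succ_lt_norm_sub_le (hF : ∀ i, Measurable fun p : E d × Ξ => F i p.1 p.2)
    {c : E d} {r : ℝ} {i : ℕ} (hFc : ∀ x ξ, ‖F (i + 1) x ξ - c‖ ≤ r) (R : ℝ) :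
    chainLaw κ x0 σ F (i + 1) {x | r + R < ‖x - c‖} ≤ gauss d (σ (i + 1)) {ζ | R < ‖ζ‖} := by
  have := isProbabilityMeasure_chainLaw (κ := κ) (x0 := x0) (σ := σ) hF i
  rw [chainLaw, Measure.map_apply (measurable_chainStep hF _)
    (measurableSet_lt measurable_const (by fun_prop))]
  have hsub : (fun p : (E d × Ξ) × E d => F (i + 1) p.1.1 p.1.2 + p.2) ⁻¹' {x | r + R < ‖x - c‖} ⊆
      Set.univ ×ˢ {ζ | R < ‖ζ‖} := fun p hp => by
    have hlt : r + R < ‖F (i + 1) p.1.1 p.1.2 + p.2 - c‖ := hp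
    rw [add_sub_right_comm] at hlt
    have hζ : R < ‖p.2‖ := by
      linarith [norm_add_le (F (i + 1) p.1.1 p.1.2 - c) p.2, hFc p.1.1 p.1.2]
    exact ⟨Set.mem_univ _, hζ⟩
  refine (measure_mono hsub).trans_eq ?_
  rw [Measure.prod_prod, measure_univ, one_mul]

end Chain

namespace Params

variable {d : ℕ} (P : Params d) {i m : ℕ}

theorem one_le_Ti (hi : i ≤ P.k) : 1 ≤ P.Ti i :=
  Nat.div_pos (Nat.pow_le_pow_right two_pos hi) (by positivity)

theorem Ti_le (hT : 1 ≤ P.T) (i : ℕ) : P.Ti i ≤ P.T :=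
  (Nat.div_le_self _ _).trans (Nat.pow_log_le_self 2 (by lia))

theorem ηi_pos (hd : d ≠ 0) (hr : 0 < P.r) (hβ : 0 < P.β) (hL : 0 < P.L) (hT : 1 ≤ P.T) (i : ℕ) :
    0 < P.ηi i := by
  have : (0 : ℝ) < d := by exact_mod_cast Nat.pos_of_ne_zero hd
  have : (0 : ℝ) < P.T := by exact_mod_cast hT
  have : 0 < min (1 / √(P.T : ℝ)) (P.β / √(d : ℝ)) := lt_min (by positivity) (by positivity)
  unfold ηi η
  positivity

theorem σi_pos (hη : 0 < P.ηi i) (hβ : 0 < P.β) (hL : 0 < P.L) : 0 < P.σi i :=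
  div_pos (mul_pos hL hη) hβ

theorem ηi_mul_le {c : ℝ} (hi : 1 ≤ i) (hr : 0 ≤ P.r) (hL : 0 < P.L) (hc : 0 ≤ c)
    (hmin : min (1 / √(P.T : ℝ)) (P.β / √(d : ℝ)) ≤ c) : P.ηi i * P.L ≤ P.r * c / 4 := by
  have h4 : (4 : ℝ) ≤ 4 ^ i := le_self_pow₀ (by norm_num) (by lia)
  calc P.ηi i * P.L = P.r * min (1 / √(P.T : ℝ)) (P.β / √(d : ℝ)) / 4 ^ i := by
        unfold ηi η
        field_simp
    _ ≤ P.r * c / 4 := by gcongr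

theorem ηi_mul_div_le (hi : 1 ≤ i) (hr : 0 ≤ P.r) (hρ : 0 < P.ρ) (hL : 0 < P.L) :
    P.ηi i * P.L / P.ρ ≤ P.r / P.ρ / (4 * √(P.T : ℝ)) := by
  refine (div_le_div_of_nonneg_right
    (P.ηi_mul_le hi hr hL (by positivity) (min_le_left _ _)) hρ.le).trans_eq ?_
  ring

theorem σi_mul_sqrt_le (hi : 1 ≤ i) (hd : d ≠ 0) (hr : 0 ≤ P.r) (hβ : 0 < P.β) (hL : 0 < P.L) :
    P.σi i * √(d : ℝ) ≤ P.r / 4 := by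
  have : (0 : ℝ) < d := by exact_mod_cast Nat.pos_of_ne_zero hd
  calc P.σi i * √(d : ℝ) = P.ηi i * P.L * (√(d : ℝ) / P.β) := by rw [σi]; ring
    _ ≤ P.r * (P.β / √(d : ℝ)) / 4 * (√(d : ℝ) / P.β) := by
        gcongr
        exact P.ηi_mul_le hi hr hL (by positivity) (min_le_right _ _)
    _ = P.r / 4 := by field_simp

theorem ηi_mul_div_mul_le (hi : 1 ≤ i) (hr : 0 ≤ P.r) (hρ : 0 < P.ρ) (hL : 0 < P.L) (hT : 1 ≤ P.T)
    (hm : 1 ≤ m) (hmr : 144 * m ^ 2 * (P.r / P.ρ) ≤ 1) :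
    P.ηi i * P.L / P.ρ * (2 * m + 2) ≤ 1 / 4 := by
  have hm1 : (1 : ℝ) ≤ m := by exact_mod_cast hm
  have hsqrt : 1 ≤ √(P.T : ℝ) := Real.one_le_sqrt.2 (by exact_mod_cast hT)
  have hκ : P.ηi i * P.L / P.ρ ≤ P.r / P.ρ / 4 :=
    (P.ηi_mul_div_le hi hr hρ hL).trans (div_le_div_of_nonneg_left (by positivity) four_pos
      (by linarith))
  calc P.ηi i * P.L / P.ρ * (2 * m + 2) ≤ P.r / P.ρ / 4 * (4 * m ^ 2) :=
        mul_le_mul hκ (by nlinarith) (by positivity) (by positivity)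
    _ ≤ 1 / 4 := by linarith

theorem Ti_mul_ηi_mul_div_sq_le (hi : 1 ≤ i) (hr : 0 ≤ P.r) (hρ : 0 < P.ρ) (hL : 0 < P.L)
    (hη : 0 ≤ P.ηi i) (hT : 1 ≤ P.T) (hm : 1 ≤ m) (hmr : 144 * m ^ 2 * (P.r / P.ρ) ≤ 1) :
    P.Ti i * (500 * m ^ 2 * (P.ηi i * P.L / P.ρ) ^ 2) ≤ 1 / 10 := by
  have hm1 : (1 : ℝ) ≤ m := by exact_mod_cast hm
  have hT0 : (0 : ℝ) < P.T := by exact_mod_cast hT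
  have : 0 ≤ P.r / P.ρ := by positivity
  have hmτ : m * (P.r / P.ρ) ≤ 1 / 144 := by nlinarith
  have hstep : P.Ti i * (P.ηi i * P.L / P.ρ) ^ 2 ≤ (P.r / P.ρ) ^ 2 / 16 := by
    calc P.Ti i * (P.ηi i * P.L / P.ρ) ^ 2
        ≤ P.T * (P.r / P.ρ / (4 * √(P.T : ℝ))) ^ 2 :=
          mul_le_mul (by exact_mod_cast P.Ti_le hT i)
            (pow_le_pow_left₀ (by positivity) (P.ηi_mul_div_le hi hr hρ hL) 2)
            (by positivity) hT0.le
      _ = (P.r / P.ρ) ^ 2 / 16 := by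
          rw [div_pow, mul_pow, Real.sq_sqrt hT0.le]
          field_simp
          norm_num
  calc P.Ti i * (500 * m ^ 2 * (P.ηi i * P.L / P.ρ) ^ 2)
      = 500 * m ^ 2 * (P.Ti i * (P.ηi i * P.L / P.ρ) ^ 2) := by ring
    _ ≤ 500 * m ^ 2 * ((P.r / P.ρ) ^ 2 / 16) := by gcongr
    _ = 500 / 16 * (m * (P.r / P.ρ)) ^ 2 := by ring
    _ ≤ 500 / 16 * (1 / 144) ^ 2 := by gcongr
    _ ≤ 1 / 10 := by norm_num

theorem four_mul_r_div_le (hr : 0 ≤ P.r) (hρ : 0 < P.ρ) (hm : 1 ≤ m)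
    (hmr : 144 * m ^ 2 * (P.r / P.ρ) ≤ 1) : (2 * m + 4) * (4 * m * P.r / P.ρ) ≤ 1 / 6 := by
  have hm1 : (1 : ℝ) ≤ m := by exact_mod_cast hm
  calc (2 * m + 4) * (4 * m * P.r / P.ρ) ≤ 6 * m * (4 * m * P.r / P.ρ) := by gcongr; linarith
    _ = 24 * m ^ 2 * (P.r / P.ρ) := by ring
    _ ≤ 1 / 6 := by linarith

end Params

theorem gauss_three_mul_lt_norm_le {d m : ℕ} {σ r : ℝ} (hd : d ≠ 0) (hσ : 0 < σ)
    (hσr : σ * √(d : ℝ) ≤ r / 4) (hm : 1 ≤ m) :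
    gauss d σ {ζ | 3 * m * r < ‖ζ‖} ≤ ENNReal.ofReal ((1 / 100) ^ m) := by
  have hd1 : (1 : ℝ) ≤ d := by exact_mod_cast Nat.one_le_iff_ne_zero.2 hd
  have hm1 : (1 : ℝ) ≤ m := by exact_mod_cast hm
  have hr : 0 ≤ r := by linarith [show 0 ≤ σ * √(d : ℝ) by positivity]
  have hrσ : 36 * m ^ 2 * d ≤ (3 * m * r) ^ 2 / (4 * σ ^ 2) := by
    have hsq : σ ^ 2 * d ≤ (r / 4) ^ 2 := by
      calc σ ^ 2 * d = (σ * √(d : ℝ)) ^ 2 := by rw [mul_pow, Real.sq_sqrt (by positivity)]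
        _ ≤ (r / 4) ^ 2 := by gcongr
    rw [le_div_iff₀ (by positivity)]
    nlinarith [mul_le_mul_of_nonneg_left hsq (sq_nonneg (m : ℝ))]
  have htwo : (2 : ℝ) ^ ((d : ℝ) / 2) ≤ Real.exp (d / 2) := by
    rw [← Real.exp_one_rpow]
    gcongr
    linarith [Real.add_one_le_exp 1]
  have hexp : Real.exp (-35) ≤ 1 / 100 := by
    rw [Real.exp_neg, one_div]
    gcongr
    linarith [Real.quadratic_le_exp_of_nonneg (x := 35) (by norm_num)]
  refine (gauss_norm_gt_le hσ (by positivity)).trans (ENNReal.ofReal_le_ofReal ?_)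
  calc (2 : ℝ) ^ ((d : ℝ) / 2) * Real.exp (-((3 * m * r) ^ 2 / (4 * σ ^ 2)))
      ≤ Real.exp (d / 2) * Real.exp (-(36 * m ^ 2 * d)) := by gcongr
    _ = Real.exp (d / 2 - 36 * m ^ 2 * d) := by rw [← Real.exp_add, sub_eq_add_neg]
    _ ≤ Real.exp (m * -35) := by
        gcongr
        nlinarith [mul_le_mul_of_nonneg_left hd1 (sq_nonneg (m : ℝ)), mul_self_nonneg (m - 1 : ℝ)]
    _ = Real.exp (-35) ^ m := Real.exp_nat_mul _ _
    _ ≤ (1 / 100) ^ m := by gcongr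

theorem measure_prod_le_add {X Y : Type*} [MeasurableSpace X] [MeasurableSpace Y] {μ : Measure X}
    [IsProbabilityMeasure μ] {κ : Measure Y} [IsProbabilityMeasure κ] {A : Set X}
    (hA : MeasurableSet A) {B : Set (X × Y)} (hB : MeasurableSet B) {e : ℝ≥0∞}
    (h : ∀ x ∉ A, κ (Prod.mk x ⁻¹' B) ≤ e) : μ.prod κ B ≤ μ A + e := by
  rw [Measure.prod_apply hB]
  calc ∫⁻ x, κ (Prod.mk x ⁻¹' B) ∂μ ≤ ∫⁻ x, A.indicator 1 x + e ∂μ := by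
        refine lintegral_mono fun x => ?_
        by_cases hx : x ∈ A
        · rw [Set.indicator_of_mem hx]
          exact prob_le_one.trans le_self_add
        · exact (h x hx).trans le_add_self
    _ = μ A + e := by
        rw [lintegral_add_right _ measurable_const, lintegral_indicator_one hA, lintegral_const,
          measure_univ, mul_one]

section Solver

variable {d n : ℕ} {S : Type*} {P : Params d} {g : S → E d → E d} {D D' : Fin n → S}
  {z : ℕ → ℕ → Fin n} {a : Fin n} {m : ℕ}

theorem outerLaw_eq_chainLaw (hr : 0 ≤ P.r) (hg : ∀ s, Measurable (g s)) (i : ℕ) :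
    outerLaw P g D z i = chainLaw (gaussSeq d P.ρ) P.xbar P.σi (innerAvg P g D z) i := by
  induction i with
  | zero => rfl
  | succ i ih =>
    have hF (i : ℕ) := measurable_innerAvg (D := D) (z := z) (i := i) hr hg
    have := isProbabilityMeasure_chainLaw (κ := gaussSeq d P.ρ) (x0 := P.xbar) (σ := P.σi) hF i
    have hstep : Measurable fun ω : E d × (ℕ → E d) × E d =>
        innerAvg P g D z (i + 1) ω.1 ω.2.1 + ω.2.2 :=
      ((hF _).comp (measurable_fst.prodMk measurable_snd.fst)).add measurable_snd.snd
    rw [outerLaw, ih, ← Measure.prodAssoc_prod, Measure.map_map hstep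
      (MeasurableEquiv.measurable _)]
    rfl

theorem isProbabilityMeasure_outerLaw (hr : 0 ≤ P.r) (hg : ∀ s, Measurable (g s)) (i : ℕ) :
    IsProbabilityMeasure (outerLaw P g D z i) := by
  rw [outerLaw_eq_chainLaw hr hg]
  exact isProbabilityMeasure_chainLaw (fun _ => measurable_innerAvg hr hg) i

theorem outerLaw_lt_norm_sub_le (hd : d ≠ 0) (hr : 0 < P.r) (hβ : 0 < P.β) (hL : 0 < P.L)
    (hT : 1 ≤ P.T) (hg : ∀ s, Measurable (g s)) (hm : 1 ≤ m) {i : ℕ} (hi : i ≤ P.k) :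
    outerLaw P g D z i {x | 4 * m * P.r < ‖x - P.xbar‖} ≤ ENNReal.ofReal ((1 / 100) ^ m) := by
  have hm1 : (1 : ℝ) ≤ m := by exact_mod_cast hm
  cases i with
  | zero =>
    have hnull : Measure.dirac P.xbar {x | 4 * m * P.r < ‖x - P.xbar‖} = 0 := by
      rw [Measure.dirac_apply' _ (measurableSet_lt measurable_const (by fun_prop))]
      refine Set.indicator_of_notMem ?_ _
      rw [Set.mem_ofPred_eq, sub_self, norm_zero, not_lt]
      positivity
    exact hnull.trans_le zero_le
  | succ i =>
    rw [outerLaw_eq_chainLaw hr.le hg]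
    have hstep := chainLaw_succ_lt_norm_sub_le (κ := gaussSeq d P.ρ) (x0 := P.xbar) (σ := P.σi)
      (F := innerAvg P g D z) (i := i) (fun _ => measurable_innerAvg hr.le hg)
      (fun x ξ => norm_innerAvg_sub_xbar_le hr.le (P.one_le_Ti hi) x ξ) (3 * m * P.r)
    have htail := gauss_three_mul_lt_norm_le hd (P.σi_pos (P.ηi_pos hd hr hβ hL hT _) hβ hL)
      (P.σi_mul_sqrt_le i.succ_pos hd hr.le hβ hL) hm
    refine (measure_mono fun x (hx : 4 * m * P.r < ‖x - P.xbar‖) => ?_).trans (hstep.trans htail)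
    have hrad : P.r + 3 * m * P.r ≤ 4 * m * P.r := by nlinarith
    exact hrad.trans_lt hx

theorem measure_prod_lt_norm_innerAvg_sub_le (hd : d ≠ 0) (hr : 0 < P.r) (hρ : 0 < P.ρ)
    (hβ : 0 < P.β) (hL : 0 < P.L) (hT : 1 ≤ P.T) (hg : ∀ s, IsBoundedMonotone P.L (g s))
    (hD : ∀ b, b ≠ a → D b = D' b) (hm : 1 ≤ m) (hmr : 144 * m ^ 2 * (P.r / P.ρ) ≤ 1)
    {i : ℕ} (hi : i < P.k) :
    (outerLaw P g D' z i).prod (gaussSeq d P.ρ)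
        {p | 50 * (P.ηi (i + 1) * P.L) * hits (z (i + 1)) a (P.Ti (i + 1)) <
          ‖innerAvg P g D z (i + 1) p.1 p.2 - innerAvg P g D' z (i + 1) p.1 p.2‖} ≤
      ENNReal.ofReal (2 * (1 / 100) ^ m) := by
  have hm1 : (1 : ℝ) ≤ m := by exact_mod_cast hm
  have hgm (s : S) : Measurable (g s) := (hg s).measurable
  have hη := P.ηi_pos hd hr hβ hL hT (i + 1)
  have hi1 : 1 ≤ i + 1 := i.succ_pos
  have := isProbabilityMeasure_outerLaw (D := D') (z := z) hr.le hgm i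
  refine (measure_prod_le_add (A := {x | 4 * m * P.r < ‖x - P.xbar‖})
    (measurableSet_lt measurable_const (by fun_prop)) (measurableSet_lt measurable_const
      ((measurable_innerAvg hr.le hgm).sub (measurable_innerAvg hr.le hgm)).norm)
    fun x hx => measure_lt_norm_innerAvg_sub_le hr.le hρ hL hg hD hη (P.one_le_Ti hi) (by lia)
      (by nlinarith) (P.ηi_mul_div_mul_le hi1 hr.le hρ hL hT hm hmr)
      (P.Ti_mul_ηi_mul_div_sq_le hi1 hr.le hρ hL hη.le hT hm hmr)
      (P.four_mul_r_div_le hr.le hρ hm hmr) (not_lt.1 hx)).trans ?_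
  rw [two_mul, ENNReal.ofReal_add (by positivity) (by positivity)]
  exact add_le_add_left (outerLaw_lt_norm_sub_le hd hr hβ hL hT hgm hm hi.le) _

theorem sum_renyi_budget_le {α : ℝ} (hα : 0 ≤ α) (hβ : 0 < P.β) (hL : 0 < P.L)
    (hη : ∀ i, 0 < P.ηi i) :
    ∑ i ∈ Finset.Icc 1 P.k, α * (50 * (P.ηi i * P.L) * hits (z i) a (P.Ti i)) ^ 2 /
        (2 * P.σi i ^ 2) ≤
      1500 * α * P.β ^ 2 * (occurrences P z a : ℝ) ^ 2 := by
  have hocc : (occurrences P z a : ℝ) = ∑ i ∈ Finset.Icc 1 P.k, (hits (z i) a (P.Ti i) : ℝ) := by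
    rw [← Nat.cast_sum]
    rfl
  have hterm (i : ℕ) : α * (50 * (P.ηi i * P.L) * hits (z i) a (P.Ti i)) ^ 2 / (2 * P.σi i ^ 2) =
      1250 * α * P.β ^ 2 * (hits (z i) a (P.Ti i) : ℝ) ^ 2 := by
    have := hη i
    rw [Params.σi]
    field_simp
    ring
  calc _ = 1250 * α * P.β ^ 2 * ∑ i ∈ Finset.Icc 1 P.k, (hits (z i) a (P.Ti i) : ℝ) ^ 2 := by
        simp_rw [hterm, Finset.mul_sum]
    _ ≤ 1500 * α * P.β ^ 2 * (occurrences P z a : ℝ) ^ 2 := by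
        rw [hocc]
        gcongr
        · norm_num
        · exact Finset.sum_sq_le_sq_sum_of_nonneg fun i _ => Nat.cast_nonneg _

theorem exists_law_near_outputLaw (hd : d ≠ 0) (hr : 0 < P.r) (hρ : 0 < P.ρ) (hβ : 0 < P.β)
    (hL : 0 < P.L) (hT : 1 ≤ P.T) (hg : ∀ s, IsBoundedMonotone P.L (g s))
    (hD : ∀ b, b ≠ a → D b = D' b) (hm : 1 ≤ m) (hmr : 144 * m ^ 2 * (P.r / P.ρ) ≤ 1) {α q : ℝ}
    (hq : α.HolderConjugate q) :
    ∃ ν : Measure (E d), IsProbabilityMeasure ν ∧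
      TVBound (ENNReal.ofReal (P.k * (2 * (1 / 100) ^ m))) ν (outputLaw P g D' z) ∧
      RenyiBound q (1500 * α * P.β ^ 2 * (occurrences P z a : ℝ) ^ 2) (outputLaw P g D z) ν := by
  have hgm (s : S) : Measurable (g s) := (hg s).measurable
  have hη := P.ηi_pos hd hr hβ hL hT
  obtain ⟨ν, hν, htv, hren⟩ := exists_law_near_chainLaw (κ := gaussSeq d P.ρ) (x0 := P.xbar)
    (σ := P.σi) (Δ := fun i => 50 * (P.ηi i * P.L) * hits (z i) a (P.Ti i)) (k := P.k)
    (F := innerAvg P g D z) (G := innerAvg P g D' z) hq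
    (fun _ => measurable_innerAvg hr.le hgm) (fun _ => measurable_innerAvg hr.le hgm)
    (fun i => by have := hη i; positivity) (fun i => P.σi_pos (hη i) hβ hL)
    (e := fun _ => ENNReal.ofReal (2 * (1 / 100) ^ m)) fun i hi => by
      rw [← outerLaw_eq_chainLaw hr.le hgm]
      exact measure_prod_lt_norm_innerAvg_sub_le hd hr hρ hβ hL hT hg hD hm hmr hi
  rw [← outerLaw_eq_chainLaw hr.le hgm] at htv hren
  refine ⟨ν, hν, htv.mono (le_of_eq ?_),
    hren.mono hq.symm.pos (sum_renyi_budget_le hq.pos.le hβ hL hη)⟩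
  rw [Finset.sum_const, Finset.card_range, nsmul_eq_mul,
    ENNReal.ofReal_mul P.k.cast_nonneg, ENNReal.ofReal_natCast]

end Solver

theorem ceil_sq_le {p : ℝ} (hp : 3 / 10 ≤ p) : (⌈p⌉₊ : ℝ) ^ 2 ≤ 12 * p ^ 2 := by
  rcases le_or_gt p 1 with h | h
  · have hceil : (⌈p⌉₊ : ℝ) ≤ 1 := by exact_mod_cast Nat.ceil_le.2 (by simpa using h)
    nlinarith [(⌈p⌉₊).cast_nonneg (α := ℝ)]
  · have hceil := Nat.ceil_lt_add_one (by linarith : 0 ≤ p)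
    nlinarith [(⌈p⌉₊).cast_nonneg (α := ℝ)]

theorem three_tenths_le_log {x : ℝ} (hx : 2 * Real.log 2 ≤ x) : 3 / 10 ≤ Real.log x := by
  have hx0 : 0 < x := by linarith [Real.log_two_gt_d9]
  have hexp : Real.exp (3 / 10) ≤ 1.386 := by
    refine le_of_pow_le_pow_left₀ (n := 10) (by norm_num) (by norm_num) ?_
    calc Real.exp (3 / 10) ^ 10 = Real.exp 1 ^ 3 := by
          rw [← Real.exp_nat_mul, ← Real.exp_nat_mul]
          norm_num
      _ ≤ 2.72 ^ 3 := by
          gcongr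
          linarith [Real.exp_one_lt_d9]
      _ ≤ 1.386 ^ 10 := by norm_num
  rw [Real.le_log_iff_exp_le hx0]
  linarith [Real.log_two_gt_d9]

theorem exp_mul_two_mul_pow_le_log_two {m : ℕ} (hm : 1 ≤ m) :
    Real.exp m * (2 * (1 / 100) ^ m) ≤ Real.log 2 := by
  have hbase : Real.exp 1 * (1 / 100) ≤ 0.03 := by linarith [Real.exp_one_lt_d9]
  calc Real.exp m * (2 * (1 / 100) ^ m) = 2 * (Real.exp 1 * (1 / 100)) ^ m := by
        rw [mul_pow, Real.exp_one_pow]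
        ring
    _ ≤ 2 * 0.03 := by
        gcongr
        exact (pow_le_of_le_one (by positivity) (hbase.trans (by norm_num)) (by lia)).trans hbase
    _ ≤ Real.log 2 := by linarith [Real.log_two_gt_d9]

theorem exists_moment_exponent {T : ℕ} (hT : 2 ≤ T) {δ τ : ℝ} (hδ : 0 < δ) (hδ2 : δ < 1 / 2)
    (hτ : 0 < τ) (hbound : 1728 * Real.log (Real.log T / δ) ^ 2 ≤ 1 / τ) :
    ∃ m : ℕ, 1 ≤ m ∧ 144 * m ^ 2 * τ ≤ 1 ∧ Nat.log 2 T * (2 * (1 / 100 : ℝ) ^ m) ≤ δ := by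
  have hlog2 : 0 < Real.log 2 := Real.log_pos one_lt_two
  have hlogT : Real.log 2 ≤ Real.log T := Real.log_le_log two_pos (by exact_mod_cast hT)
  have hratio : 2 * Real.log 2 ≤ Real.log T / δ := by
    rw [le_div_iff₀ hδ]
    nlinarith
  have hp := three_tenths_le_log hratio
  set p := Real.log (Real.log T / δ)
  have hm : 1 ≤ ⌈p⌉₊ := Nat.one_le_ceil_iff.2 (by linarith)
  refine ⟨⌈p⌉₊, hm, ?_, ?_⟩
  · rw [← le_div_iff₀ hτ]
    linarith [ceil_sq_le hp]
  have hexp : Real.log T ≤ δ * Real.exp ⌈p⌉₊ := by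
    rw [← div_le_iff₀' hδ, ← Real.log_le_iff_le_exp (by linarith)]
    exact Nat.le_ceil p
  have hk : Nat.log 2 T * Real.log 2 ≤ Real.log T :=
    (le_div_iff₀ hlog2).1 (Real.natLog_le_logb T 2)
  refine le_of_mul_le_mul_right ?_ hlog2
  calc Nat.log 2 T * (2 * (1 / 100 : ℝ) ^ ⌈p⌉₊) * Real.log 2
      = Nat.log 2 T * Real.log 2 * (2 * (1 / 100) ^ ⌈p⌉₊) := by ring
    _ ≤ δ * Real.exp ⌈p⌉₊ * (2 * (1 / 100) ^ ⌈p⌉₊) := by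
        exact mul_le_mul_of_nonneg_right (hk.trans hexp) (by positivity)
    _ = δ * (Real.exp ⌈p⌉₊ * (2 * (1 / 100) ^ ⌈p⌉₊)) := by ring
    _ ≤ δ * Real.log 2 := by
        gcongr
        exact exp_mul_two_mul_pow_le_log_two hm

section MainTheorem

variable {d n : ℕ} {S : Type*} {P : Params d} {g : S → E d → E d} {D D' : Fin n → S}
  {z : ℕ → ℕ → Fin n} {a : Fin n}

theorem exists_law_near_outputLaw_of_lt_half (hr : 0 < P.r) (hρ : 0 < P.ρ) (hβ : 0 < P.β)
    (hL : 0 < P.L) (hT : 1 ≤ P.T) (hg : ∀ s, IsBoundedMonotone P.L (g s))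
    (hD : ∀ b, b ≠ a → D b = D' b) {δ : ℝ} (hδ : 0 < δ) (hδ2 : δ < 1 / 2)
    (hbound : 1728 * Real.log (Real.log P.T / δ) ^ 2 ≤ P.ρ / P.r) {α q : ℝ}
    (hq : α.HolderConjugate q) :
    ∃ ν : Measure (E d), IsProbabilityMeasure ν ∧
      TVBound (ENNReal.ofReal δ) ν (outputLaw P g D' z) ∧
      RenyiBound q (1500 * α * P.β ^ 2 * (occurrences P z a : ℝ) ^ 2) (outputLaw P g D z) ν := by
  have hprob (D : Fin n → S) : IsProbabilityMeasure (outputLaw P g D z) :=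
    isProbabilityMeasure_outerLaw hr.le (fun s => (hg s).measurable) _
  by_cases heq : outputLaw P g D z = outputLaw P g D' z
  · have := hq.pos
    exact ⟨outputLaw P g D z, hprob D, heq ▸ (TVBound.refl _).mono zero_le,
      (RenyiBound.refl hq _).mono hq.symm.pos (by positivity)⟩
  have hd : d ≠ 0 := by
    rintro rfl
    refine heq (Measure.ext fun s _ => Subsingleton.set_cases (p := fun s =>
      outputLaw P g D z s = outputLaw P g D' z s) ?_ ?_ s)
    · simp only [measure_empty]
    · simp only [measure_univ]
  have hT2 : 2 ≤ P.T := by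
    refine hT.lt_of_ne fun hT1 => heq ?_
    have hk : P.k = 0 := by rw [Params.k, ← hT1, Nat.log_one_right]
    rw [outputLaw, outputLaw, hk, outerLaw, outerLaw]
  obtain ⟨m, hm, hmr, hmδ⟩ := exists_moment_exponent hT2 hδ hδ2 (div_pos hr hρ)
    (by rwa [one_div_div])
  obtain ⟨ν, hν, htv, hren⟩ := exists_law_near_outputLaw hd hr hρ hβ hL hT hg hD hm hmr hq
  exact ⟨ν, hν, htv.mono (ENNReal.ofReal_le_ofReal hmδ), hren⟩

theorem Neighboring.eq_of_ne (hD : Neighboring D D') (ha : D a ≠ D' a) {b : Fin n} (hb : b ≠ a) :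
    D b = D' b := by
  obtain ⟨c, hc⟩ := Set.ncard_eq_one.1 hD
  have hdiff (i : Fin n) : D i ≠ D' i ↔ i = c := Set.ext_iff.1 hc i
  by_contra hne
  exact hb (((hdiff b).1 hne).trans ((hdiff a).1 ha).symm)

end MainTheorem

end ReSQue

open ReSQue in
theorem lemma4p5_general {d n : ℕ} {S : Type*} {P : Params d} {g : S → E d → E d}
    {D D' : Fin n → S} {a : Fin n} (hr : 0 < P.r) (hρ : 0 < P.ρ) (hβ : 0 < P.β) (hL : 0 < P.L)
    (hT : 1 ≤ P.T) (hg : ∀ s, IsBoundedMonotone P.L (g s)) (hD : ∀ b, b ≠ a → D b = D' b)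
    (z : ℕ → ℕ → Fin n) {δ : ℝ} (hδ : 0 < δ)
    (hbound : 1728 * Real.log (Real.log P.T / δ) ^ 2 ≤ P.ρ / P.r) {α : ℝ} (hα : 1 < α) :
    approxRenyiDiv α δ (outputLaw P g D z) (outputLaw P g D' z) ≤
        ((1500 * α * P.β ^ 2 * (occurrences P z a : ℝ) ^ 2 : ℝ) : EReal) ∧
      ∃ μ' ν' : ProbabilityMeasure (E d),
        tvDist (μ' : Measure (E d)) (outputLaw P g D z) ≤ δ ∧
        tvDist (ν' : Measure (E d)) (outputLaw P g D' z) ≤ δ ∧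
        renyiDiv α (μ' : Measure (E d)) (ν' : Measure (E d)) ≤
          ((1500 * α * P.β ^ 2 * (occurrences P z a : ℝ) ^ 2 : ℝ) : EReal) := by
  have hq := Real.HolderConjugate.conjExponent hα
  have hprob (D : Fin n → S) : IsProbabilityMeasure (outputLaw P g D z) :=
    isProbabilityMeasure_outerLaw hr.le (fun s => (hg s).measurable) _
  -- For `δ ≥ 1 / 2` the logarithm in `hbound` can vanish, but then the midpoint of the two laws is
  -- within `δ` of both.
  rcases le_or_gt (1 / 2) δ with hδ2 | hδ2
  · have hhalf : (2⁻¹ : ℝ≥0∞) ≤ ENNReal.ofReal δ := by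
      simpa using ENNReal.ofReal_le_ofReal hδ2
    have := isProbabilityMeasure_midpoint (outputLaw P g D z) (outputLaw P g D' z)
    have := hprob D
    have htv := tvBound_midpoint (outputLaw P g D' z) (outputLaw P g D z)
    rw [add_comm] at htv
    exact RenyiBound.approxRenyiDiv_le_and_exists hq hδ.le
      ((RenyiBound.refl hq _).mono hq.symm.pos (by have := hq.pos; positivity))
      ((tvBound_midpoint _ _).mono hhalf) (htv.mono hhalf)
  · obtain ⟨ν, _, htv, hren⟩ :=
      exists_law_near_outputLaw_of_lt_half hr hρ hβ hL hT hg hD hδ hδ2 hbound hq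
    exact hren.approxRenyiDiv_le_and_exists hq hδ.le ((TVBound.refl _).mono zero_le) htv

theorem lemma4p5 {d n : ℕ} [NeZero n] {S : Type*}
    (f : S → ReSQue.E d → ℝ) (g : S → ReSQue.E d → ReSQue.E d) (P : ReSQue.Params d)
    (hr : 0 < P.r) (hρ : 0 < P.ρ) (hβ : 0 < P.β) (hL : 0 < P.L) (hT : 1 ≤ P.T)
    (hconv : ∀ s, ConvexOn ℝ Set.univ (f s))
    (hlip : ∀ s x y, |f s x - f s y| ≤ P.L * ‖x - y‖)
    (hgm : ∀ s, Measurable (g s))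
    (hg : ∀ s x, ReSQue.IsSubgradient (f s) x (g s x))
    (D D' : Fin n → S) (hD : ReSQue.Neighboring D D') (hD0 : D 0 ≠ D' 0)
    (z : ℕ → ℕ → Fin n) (δ : ℝ) (hδ : 0 < δ)
    (hbound : 1728 * Real.log (Real.log P.T / δ) ^ 2 ≤ P.ρ / P.r)
    (α : ℝ) (hα : 1 < α) :
    ReSQue.approxRenyiDiv α δ (ReSQue.outputLaw P g D z) (ReSQue.outputLaw P g D' z) ≤
        ((1500 * α * P.β ^ 2 * (ReSQue.occurrences P z 0 : ℝ) ^ 2 : ℝ) : EReal) ∧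
      ∃ μ' ν' : MeasureTheory.ProbabilityMeasure (ReSQue.E d),
        ReSQue.tvDist (μ' : MeasureTheory.Measure (ReSQue.E d)) (ReSQue.outputLaw P g D z) ≤ δ ∧
        ReSQue.tvDist (ν' : MeasureTheory.Measure (ReSQue.E d)) (ReSQue.outputLaw P g D' z) ≤ δ ∧
        ReSQue.renyiDiv α (μ' : MeasureTheory.Measure (ReSQue.E d))
            (ν' : MeasureTheory.Measure (ReSQue.E d)) ≤
          ((1500 * α * P.β ^ 2 * (ReSQue.occurrences P z 0 : ℝ) ^ 2 : ℝ) : EReal) := by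
  have hgL (s : S) : ReSQue.IsBoundedMonotone P.L (g s) :=
    .of_isSubgradient hL.le (hlip s) (hgm s) (hg s)
  exact lemma4p5_general hr hρ hβ hL hT hgL (fun _ hb => hD.eq_of_ne hD0 hb) z hδ hbound hα
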